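/- Let $K$ be an algebraically closed field with a valuation $v$, written additively, with value group $\Gamma=vK$ (a divisible ordered abelian group). For $a\in K$, $\gamma\in\Gamma$ put $B(a,\gamma)=\{c\in K: v(c-a)\ge\gamma\}$ and $B^{\circ}(a,\gamma)=\{c\in K: v(c-a)>\gamma\}$ (closed and open balls). A quasi-cut is a pair $\delta=(\delta^L,\delta^R)$ of subsets of $\Gamma$ with $\delta^L\le\delta^R$ and $\delta^L\cup\delta^R=\Gamma$; it is a cut if $\delta^L<\delta^R$; $\gamma\in\Gamma$ is identified with the quasi-cut $(\Gamma_{\le\gamma},\Gamma_{\ge\gamma})$; and $\delta\le\epsilon$ means $\delta^L\subseteq\epsilon^L$ and $\delta^R\supseteq\epsilon^R$. For a cut $\delta$ put $B(a,\delta)=\{c\in K: v(c-a)>\delta^L\}$. **Geometric side.** $\mathbb B_\Gamma$ is the set of all balls $B(a,\gamma)$ with $\gamma\in\Gamma$, and $\mathbb B_{\rm cut}$ the set of all balls $B(a,\delta)$ with $\delta$ a cut, both ordered by reverse inclusion. $\mathbb B_\infty$ is the set of nests (families totally ordered by inclusion) $\mathcal B$ of balls of $\mathbb B_\Gamma$ with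 $\bigcap\mathcal B=\emptyset$, modulo mutual cofinality; distinct elements of $\mathbb B_\infty$ are incomparable. $\mathbb B$ is the disjoint union $\mathbb B_\infty\sqcup\mathbb B_\Gamma\sqcup\mathbb B_{\rm cut}$, where balls $B,C\in\mathbb B_\Gamma\sqcup\mathbb B_{\rm cut}$ with radii $\delta,\epsilon$ satisfy $B\le C$ iff $B\supseteq C$ and $\delta\le\epsilon$; $B\le[\mathcal B]$ iff $B$ contains some member of $\mathcal B$; and an element of $\mathbb B_\infty$ is never below a ball. **Valuations.** $\mathbb V$ is the set of equivalence classes of valuations on $K(x)$ whose restriction to $K$ is equivalent to $v$. The map $\mathbb B\to\mathbb V$, $B\mapsto\omega_B$, is as follows. For $B=B(a,\gamma)\in\mathbb B_\Gamma$, $\omega_B\left(\sum_n a_n(x-a)^n\right)=\min_n\{v(a_n)+n\gamma\}$. For $B=B(a,\delta)\in\mathbb B_{\rm cut}$, $\omega_B\left(\sum_n a_n(x-a)^n\right)=\min_n\{v(a_n)+n x_\delta\}$ in the ordered group $\mathbb Z x_\delta\oplus\Gamma$ in which $\delta^L<x_\delta<\delta^R$. For $[\mathcal B]\in\mathbb B_\infty$,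 $\omega_{[\mathcal B]}(f)=\max\{\omega_B(f): B\in\mathcal B\}$ for $f\in K[x]$. **Approximation types.** For a family $\mathcal F$ of balls of $K$, its closure $\overline{\mathcal F}$ is the set of all open or closed balls of $K$ with radius in $\Gamma$ that contain some member of $\mathcal F$. An approximation type is either $\emptyset$ or a nest $\mathbf A$ of open or closed balls with $\overline{\mathbf A}=\mathbf A$; the set $\mathcal A$ of all approximation types is ordered by inclusion. Let $\operatorname{supp}(\mathbf A)$ be the set of $\gamma\in\Gamma$ such that $\mathbf A$ contains a closed ball of radius $\gamma$. Then $\mathbf A$ is immediate ($\mathbf A\in\mathcal A_\infty$) if $\mathbf A\ne\emptyset$ and $\bigcap\mathbf A=\emptyset$; residue-extending ($\mathbf A\in\mathcal A_{\rm re}$) if for some $\gamma\in\operatorname{supp}(\mathbf A)$ it contains no open ball of radius $\gamma$; value-extending ($\mathbf A\in\mathcal A_{\rm ve}$) if $\mathbf A=\emptyset$, or $\bigcap\mathbf A\neq\emptyset$ and $\mathbf A$ contains an open ball of radius $\gamma$ for every $\gamma\in\operatorname{supp}(\mathbf A)$. For $\nu\in\mathbb V$ let ${\rm appr}_\nu(x,K)$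 be the set of all nonempty intersections $B\cap K$, where $B$ runs through the open and closed $\nu$-balls of $K(x)$ centred at $x$ with radius in the value group of $K$. **Theorem.** The composition $$\mathbb B\longrightarrow\mathbb V\longrightarrow\mathcal A,\qquad B\longmapsto{\rm appr}_{\omega_B}(x,K),$$ is a well-defined isomorphism of posets $\mathbb B\to\mathcal A$, and it restricts to isomorphisms of posets $$\mathbb B_\infty\to\mathcal A_\infty,\qquad \mathbb B_\Gamma\to\mathcal A_{\rm re},\qquad \mathbb B_{\rm cut}\to\mathcal A_{\rm ve}.$$ Explicitly, it acts by $[\mathcal B]\mapsto\overline{\mathcal B}$ for $[\mathcal B]\in\mathbb B_\infty$, by $B(a,\gamma)\mapsto\overline{\{B(a,\gamma)\}}$ for $a\in K$, $\gamma\in\Gamma$, and by $B(a,\delta)\mapsto\overline{\{B^{\circ}(a,\gamma):\gamma\in\delta^L\}}$ for $a\in K$ and $\delta$ a cut in $\Gamma$. -/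

import Mathlib

universe u


namespace ValTree

open Polynomial

section Gauss

variable {K Λ : Type*} [Field K] [AddCommGroup Λ] [LinearOrder Λ] [IsOrderedAddMonoid Λ]

/-- `u(a_n) + n t`, where `a_n` is the coefficient of `x^n` in `f`. -/
noncomputable def gaussTerm (u : AddValuation K (WithTop Λ)) (t : Λ) (f : K[X]) (n : ℕ) :
    WithTop Λ :=
  u (f.coeff n) + ((n • t : Λ) : WithTop Λ)

/-- `min_n (u(a_n) + n t)`. -/
noncomputable def gaussVal (u : AddValuation K (WithTop Λ)) (t : Λ) (f : K[X]) : WithTop Λ :=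
  f.support.inf (gaussTerm u t f)

theorem gaussVal_le (u : AddValuation K (WithTop Λ)) (t : Λ) (f : K[X]) (n : ℕ) :
    gaussVal u t f ≤ gaussTerm u t f n := by
  by_cases h : n ∈ f.support
  · exact Finset.inf_le h
  · simp [gaussTerm, Polynomial.notMem_support_iff.1 h]

theorem le_gaussVal {u : AddValuation K (WithTop Λ)} {t : Λ} {f : K[X]} {m : WithTop Λ} :
    m ≤ gaussVal u t f ↔ ∀ n, m ≤ gaussTerm u t f n :=
  ⟨fun h n => h.trans (gaussVal_le u t f n), fun h => Finset.le_inf fun n _ => h n⟩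

theorem gaussVal_eq_top {u : AddValuation K (WithTop Λ)} {t : Λ} {f : K[X]} :
    gaussVal u t f = ⊤ ↔ f = 0 := by
  constructor
  · intro h
    ext n
    have := gaussVal_le u t f n
    rw [h, top_le_iff, gaussTerm, WithTop.add_eq_top] at this
    exact (AddValuation.top_iff u).1 (this.resolve_right WithTop.coe_ne_top)
  · rintro rfl
    simp [gaussVal]

theorem exists_least_term (u : AddValuation K (WithTop Λ)) (t : Λ) {f : K[X]} (hf : f ≠ 0) :
    ∃ n, gaussTerm u t f n = gaussVal u t f ∧ ∀ i < n, gaussVal u t f < gaussTerm u t f i := by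
  classical
  have hex : ∃ n, gaussTerm u t f n = gaussVal u t f := by
    obtain ⟨n, -, hn⟩ := Finset.exists_mem_eq_inf f.support
      (Polynomial.support_nonempty.2 hf) (gaussTerm u t f)
    exact ⟨n, hn.symm⟩
  refine ⟨Nat.find hex, Nat.find_spec hex, fun i hi => ?_⟩
  exact lt_of_le_of_ne (gaussVal_le u t f i) fun h => Nat.find_min hex hi h.symm

theorem gaussVal_add (u : AddValuation K (WithTop Λ)) (t : Λ) (f g : K[X]) :
    min (gaussVal u t f) (gaussVal u t g) ≤ gaussVal u t (f + g) := by
  refine le_gaussVal.2 fun n => ?_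
  have h1 := gaussVal_le u t f n
  have h2 := gaussVal_le u t g n
  have h3 : min (gaussTerm u t f n) (gaussTerm u t g n) ≤ gaussTerm u t (f + g) n := by
    unfold gaussTerm
    rw [Polynomial.coeff_add]
    rcases u.map_add' (f.coeff n) (g.coeff n) with h | h
    · exact (min_le_left _ _).trans (add_le_add_left h _)
    · exact (min_le_right _ _).trans (add_le_add_left h _)
  exact (min_le_min h1 h2).trans h3

theorem gaussTerm_mul (u : AddValuation K (WithTop Λ)) (t : Λ) (f g : K[X]) (i j : ℕ) :
    gaussTerm u t f i + gaussTerm u t g j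
      = u (f.coeff i * g.coeff j) + (((i + j) • t : Λ) : WithTop Λ) := by
  simp only [gaussTerm, AddValuation.map_mul, add_nsmul, WithTop.coe_add]
  abel

theorem gaussVal_mul (u : AddValuation K (WithTop Λ)) (t : Λ) (f g : K[X]) :
    gaussVal u t (f * g) = gaussVal u t f + gaussVal u t g := by
  classical
  by_cases hf : f = 0
  · simp [hf, gaussVal]
  by_cases hg : g = 0
  · simp [hg, gaussVal]
  have cancel : ∀ (x y : WithTop Λ) (s : Λ), x + (s : WithTop Λ) ≤ y + (s : WithTop Λ) ↔ x ≤ y :=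
    fun x y s => WithTop.add_le_add_iff_right WithTop.coe_ne_top
  have cancel' : ∀ (x y : WithTop Λ) (s : Λ), x + (s : WithTop Λ) < y + (s : WithTop Λ) ↔ x < y :=
    fun x y s => WithTop.add_lt_add_iff_right WithTop.coe_ne_top
  have hft : gaussVal u t f ≠ ⊤ := fun h => hf (gaussVal_eq_top.1 h)
  have hgt : gaussVal u t g ≠ ⊤ := fun h => hg (gaussVal_eq_top.1 h)
  apply le_antisymm
  · obtain ⟨i, hi, hi'⟩ := exists_least_term u t hf
    obtain ⟨j, hj, hj'⟩ := exists_least_term u t hg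
    refine (gaussVal_le u t (f * g) (i + j)).trans (le_of_eq ?_)
    rw [← hi, ← hj, gaussTerm_mul, gaussTerm, Polynomial.coeff_mul,
      ← Finset.add_sum_erase _ _ (show (i, j) ∈ Finset.HasAntidiagonal.antidiagonal (i + j) by simp)]
    congr 1
    have htop : u (f.coeff i * g.coeff j) ≠ ⊤ := by
      intro h
      have := gaussTerm_mul u t f g i j
      rw [h, hi, hj, WithTop.top_add, WithTop.add_eq_top] at this
      exact this.elim hft hgt
    apply AddValuation.map_add_eq_of_lt_left
    refine u.map_lt_sum htop fun p hp => ?_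
    simp only [Finset.mem_erase, Finset.HasAntidiagonal.mem_antidiagonal] at hp
    obtain ⟨hne, hsum⟩ := hp
    rw [← cancel' _ _ ((i + j) • t), ← gaussTerm_mul, ← hsum, ← gaussTerm_mul, hi, hj]
    have hcase : p.1 < i ∨ p.2 < j := by
      by_contra! h
      exact hne (Prod.ext (by simp; omega) (by simp; omega))
    rcases hcase with h | h
    · exact WithTop.add_lt_add_of_lt_of_le hgt (hi' _ h) (gaussVal_le u t g _)
    · exact WithTop.add_lt_add_of_le_of_lt hft (gaussVal_le u t f _) (hj' _ h)
  · refine le_gaussVal.2 fun n => ?_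
    rw [gaussTerm, Polynomial.coeff_mul]
    have key : gaussVal u t f + gaussVal u t g + ((-(n • t) : Λ) : WithTop Λ)
        ≤ u (∑ x ∈ Finset.HasAntidiagonal.antidiagonal n, f.coeff x.1 * g.coeff x.2) := by
      refine u.map_le_sum fun p hp => ?_
      rw [← cancel _ _ (n • t), add_assoc, ← WithTop.coe_add, neg_add_cancel, WithTop.coe_zero,
        add_zero, ← Finset.HasAntidiagonal.mem_antidiagonal.1 hp, ← gaussTerm_mul]
      exact add_le_add (gaussVal_le _ _ _ _) (gaussVal_le _ _ _ _)
    rw [← cancel _ _ (n • t), add_assoc, ← WithTop.coe_add, neg_add_cancel, WithTop.coe_zero,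
        add_zero] at key
    exact key

theorem gaussVal_C (u : AddValuation K (WithTop Λ)) (t : Λ) (c : K) :
    gaussVal u t (C c) = u c := by
  apply le_antisymm
  · simpa [gaussTerm] using gaussVal_le u t (C c) 0
  · refine le_gaussVal.2 fun n => ?_
    rcases eq_or_ne n 0 with rfl | h
    · simp [gaussTerm]
    · simp [gaussTerm, Polynomial.coeff_C, h]

/-- `gaussVal` as a valuation on `K[X]`. -/
noncomputable def gauss (u : AddValuation K (WithTop Λ)) (t : Λ) :
    AddValuation K[X] (WithTop Λ) :=
  AddValuation.of (gaussVal u t) (gaussVal_eq_top.2 rfl)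
    (by rw [← Polynomial.C_1, gaussVal_C, AddValuation.map_one])
    (gaussVal_add u t) (gaussVal_mul u t)

/-- The monomial valuation `∑ a_n (x - a)^n ↦ min_n (u(a_n) + n t)` on `K[X]`. -/
noncomputable def monomialVal (u : AddValuation K (WithTop Λ)) (a : K) (t : Λ) :
    AddValuation K[X] (WithTop Λ) :=
  (gauss u t).comap (Polynomial.taylorAlgHom a : K[X] →ₐ[K] K[X]).toRingHom

theorem monomialVal_apply (u : AddValuation K (WithTop Λ)) (a : K) (t : Λ) (f : K[X]) :
    monomialVal u a t f = (Polynomial.taylor a f).support.inf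
      fun n => u ((Polynomial.taylor a f).coeff n) + ((n • t : Λ) : WithTop Λ) := rfl

theorem monomialVal_C (u : AddValuation K (WithTop Λ)) (a : K) (t : Λ) (c : K) :
    monomialVal u a t (C c) = u c := by
  have : monomialVal u a t (C c) = gaussVal u t (Polynomial.taylor a (C c)) := rfl
  rw [this, Polynomial.taylor_C, gaussVal_C]

theorem monomialVal_eq_top {u : AddValuation K (WithTop Λ)} {a : K} {t : Λ} {f : K[X]}
    (h : monomialVal u a t f = ⊤) : f = 0 := by
  have h1 : Polynomial.taylor a f = 0 := gaussVal_eq_top.1 h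
  exact (Polynomial.taylor_eq_zero a f).1 h1

theorem monomialVal_linear (u : AddValuation K (WithTop Λ)) (a : K) (t : Λ) (b : K) :
    monomialVal u a t (X - C b) = min (u (b - a)) (t : WithTop Λ) := by
  have h0 : monomialVal u a t (X - C b) = gaussVal u t (Polynomial.taylor a (X - C b)) := rfl
  have h1 : Polynomial.taylor a (X - C b) = X + C (a - b) := by
    simp [Polynomial.taylor_X, Polynomial.taylor_C, C_sub]; ring
  rw [h0, h1]
  apply le_antisymm
  · refine le_min ?_ ?_
    · have := gaussVal_le u t (X + C (a - b)) 0
      simpa [gaussTerm, u.map_sub_swap a b] using this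
    · have := gaussVal_le u t (X + C (a - b)) 1
      simpa [gaussTerm, Polynomial.coeff_C] using this
  · refine le_gaussVal.2 fun n => ?_
    rcases n with _ | _ | n
    · simp [gaussTerm, u.map_sub_swap a b]
    · simp [gaussTerm]
    · simp [gaussTerm, Polynomial.coeff_X]

theorem monomialVal_le {u : AddValuation K (WithTop Λ)} {a : K} {t : Λ}
    {w : AddValuation K[X] (WithTop Λ)} (hw : ∀ c, w (C c) = u c)
    (ht : (t : WithTop Λ) ≤ w (X - C a)) (f : K[X]) : monomialVal u a t f ≤ w f := by
  have hsum := Polynomial.sum_taylor_eq f a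
  rw [Polynomial.sum] at hsum
  refine le_of_le_of_eq ?_ (congrArg w hsum)
  refine w.map_le_sum fun n _ => ?_
  rw [AddValuation.map_mul, AddValuation.map_pow, hw]
  refine (gaussVal_le u t (Polynomial.taylor a f) n).trans (add_le_add le_rfl ?_)
  rw [WithTop.coe_nsmul]
  exact nsmul_le_nsmul_right ht n

theorem monomialVal_mono {u : AddValuation K (WithTop Λ)} {a b : K} {s t : Λ} (hst : s ≤ t)
    (hab : (s : WithTop Λ) ≤ u (b - a)) (f : K[X]) :
    monomialVal u a s f ≤ monomialVal u b t f := by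
  refine monomialVal_le (monomialVal_C u b t) ?_ f
  rw [monomialVal_linear, u.map_sub_swap]
  exact le_min hab (WithTop.coe_le_coe.2 hst)

theorem nonZeroDivisors_le {w : AddValuation K[X] (WithTop Λ)} (hw : ∀ f, w f = ⊤ → f = 0) :
    nonZeroDivisors K[X] ≤ (AddValuation.toValuation w).supp.primeCompl :=
  fun f hf hmem => nonZeroDivisors.ne_zero hf (hw f hmem)

/-- The extension to `K(x)` of a valuation on `K[x]` with trivial support. -/
noncomputable def extendRatFunc (w : AddValuation K[X] (WithTop Λ)) (hw : ∀ f, w f = ⊤ → f = 0) :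
    AddValuation (RatFunc K) (WithTop Λ) :=
  AddValuation.ofValuation
    ((AddValuation.toValuation w).extendToLocalization
      (S := nonZeroDivisors K[X])
      (nonZeroDivisors_le hw) (RatFunc K))

theorem extendRatFunc_algebraMap (w : AddValuation K[X] (WithTop Λ)) (hw : ∀ f, w f = ⊤ → f = 0)
    (f : K[X]) : extendRatFunc w hw (algebraMap K[X] (RatFunc K) f) = w f :=
  Valuation.extendToLocalization_apply_map_apply (AddValuation.toValuation w) (nonZeroDivisors_le hw) _ _

end Gauss

section Cuts

variable {Γ : Type u} [LinearOrder Γ]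

/-- A cut `δ = (δ^L, δ^R)` in `Γ`: `δ^L < δ^R` and `δ^L ∪ δ^R = Γ`. -/
structure Cut (Γ : Type u) [LinearOrder Γ] where
  L : Set Γ
  R : Set Γ
  lt : ∀ x ∈ L, ∀ y ∈ R, x < y
  union : L ∪ R = Set.univ

/-- A quasi-cut `δ = (δ^L, δ^R)` in `Γ`: `δ^L ≤ δ^R` and `δ^L ∪ δ^R = Γ`. -/
structure QCut (Γ : Type u) [LinearOrder Γ] where
  L : Set Γ
  R : Set Γ
  le : ∀ x ∈ L, ∀ y ∈ R, x ≤ y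
  union : L ∪ R = Set.univ

instance : LE (QCut Γ) := ⟨fun δ ε => δ.L ⊆ ε.L ∧ ε.R ⊆ δ.R⟩

/-- The inclusion of cuts into quasi-cuts. -/
def Cut.toQCut (δ : Cut Γ) : QCut Γ := ⟨δ.L, δ.R, fun x hx y hy => (δ.lt x hx y hy).le, δ.union⟩

/-- The principal quasi-cut `(Γ_{≤γ}, Γ_{≥γ})` attached to `γ ∈ Γ`. -/
def QCut.principal (γ : Γ) : QCut Γ :=
  ⟨Set.Iic γ, Set.Ici γ, fun _ hx _ hy => le_trans hx hy, Set.Iic_union_Ici⟩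

theorem Cut.mem_or (δ : Cut Γ) (γ : Γ) : γ ∈ δ.L ∨ γ ∈ δ.R := by
  have : γ ∈ δ.L ∪ δ.R := δ.union ▸ Set.mem_univ γ
  exact this

theorem Cut.mem_R_iff (δ : Cut Γ) (γ : Γ) : γ ∈ δ.R ↔ γ ∉ δ.L :=
  ⟨fun hR hL => lt_irrefl _ (δ.lt γ hL γ hR), fun h => (δ.mem_or γ).resolve_left h⟩

theorem Cut.ext_L {δ ε : Cut Γ} (h : δ.L = ε.L) : δ = ε := by
  have hR : δ.R = ε.R := by
    ext γ
    rw [δ.mem_R_iff, ε.mem_R_iff, h]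
  cases δ; cases ε; simp_all

/-- Divisibility of an abelian group. -/
def IsDivisible (Γ : Type u) [AddCommGroup Γ] : Prop :=
  ∀ n : ℕ, n ≠ 0 → ∀ γ : Γ, ∃ γ' : Γ, n • γ' = γ

/-- The group `Γ(δ) = ℤ x_δ ⊕ Γ` attached to a cut `δ` of a divisible group `Γ`; the pair
`(m, γ)` stands for `m x_δ + γ`. -/
def CutGroup [AddCommGroup Γ] (_ : Cut Γ) (_ : IsDivisible Γ) : Type u := ℤ × Γ

variable [AddCommGroup Γ] {δ : Cut Γ} {hΓ : IsDivisible Γ}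

instance : AddCommGroup (CutGroup δ hΓ) := inferInstanceAs (AddCommGroup (ℤ × Γ))

/-- `m x_δ + c ≥ 0`, for the ordering of `Γ(δ)` in which `δ^L < x_δ < δ^R`. -/
def CutGroup.Nonneg (p : CutGroup δ hΓ) : Prop :=
  (p.1 = 0 ∧ 0 ≤ p.2) ∨ (0 < p.1 ∧ ∃ γ ∈ δ.L, 0 ≤ p.1 • γ + p.2) ∨
    (p.1 < 0 ∧ ∃ γ ∈ δ.R, 0 ≤ p.1 • γ + p.2)

theorem CutGroup.nonneg_total_aux (p : CutGroup δ hΓ) (h0 : 0 < p.1) :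
    p.Nonneg ∨ (-p).Nonneg := by
  have e1 : (-p).1 = -p.1 := rfl
  have e2 : (-p).2 = -p.2 := rfl
  obtain ⟨n, hn⟩ := Int.eq_ofNat_of_zero_le h0.le
  obtain ⟨γ, hγ⟩ := hΓ n (by omega) (-p.2)
  have hγ' : p.1 • γ + p.2 = 0 := by rw [hn, natCast_zsmul, hγ, neg_add_cancel]
  rcases δ.mem_or γ with h | h
  · exact Or.inl (Or.inr (Or.inl ⟨h0, γ, h, hγ'.ge⟩))
  · refine Or.inr (Or.inr (Or.inr ⟨by omega, γ, h, ?_⟩))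
    rw [e1, e2, neg_zsmul, ← neg_add, hγ', neg_zero]

variable [IsOrderedAddMonoid Γ]

theorem CutGroup.nonneg_add_aux {p q : CutGroup δ hΓ} (hp : 0 < p.1) {γ γ' : Γ} (hγ : γ ∈ δ.L)
    (h : 0 ≤ p.1 • γ + p.2) (hq : q.1 < 0) (hγ' : γ' ∈ δ.R) (h' : 0 ≤ q.1 • γ' + q.2) :
    CutGroup.Nonneg (p + q) := by
  have hlt := δ.lt γ hγ γ' hγ'
  have e1 : (p + q).1 = p.1 + q.1 := rfl
  have e2 : (p + q).2 = p.2 + q.2 := rfl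
  have hqγ : q.1 • γ' ≤ q.1 • γ := by
    have := zsmul_le_zsmul_right (show (0:ℤ) ≤ -q.1 by omega) hlt.le
    simpa using this
  have hpγ : p.1 • γ ≤ p.1 • γ' := zsmul_le_zsmul_right hp.le hlt.le
  have s1 : 0 ≤ (p + q).1 • γ + (p + q).2 := by
    rw [e1, e2, add_zsmul]
    calc (0 : Γ) ≤ (p.1 • γ + p.2) + (q.1 • γ' + q.2) := add_nonneg h h'
      _ ≤ (p.1 • γ + p.2) + (q.1 • γ + q.2) := by gcongr
      _ = _ := by abel
  have s2 : 0 ≤ (p + q).1 • γ' + (p + q).2 := by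
    rw [e1, e2, add_zsmul]
    calc (0 : Γ) ≤ (p.1 • γ + p.2) + (q.1 • γ' + q.2) := add_nonneg h h'
      _ ≤ (p.1 • γ' + p.2) + (q.1 • γ' + q.2) := by gcongr
      _ = _ := by abel
  rcases lt_trichotomy (p + q).1 0 with h0 | h0 | h0
  · exact Or.inr (Or.inr ⟨h0, γ', hγ', s2⟩)
  · refine Or.inl ⟨h0, ?_⟩
    simpa [h0] using s1
  · exact Or.inr (Or.inl ⟨h0, γ, hγ, s1⟩)

theorem CutGroup.nonneg_add {p q : CutGroup δ hΓ} (hp : p.Nonneg) (hq : q.Nonneg) :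
    (p + q).Nonneg := by
  have e1 : (p + q).1 = p.1 + q.1 := rfl
  have e2 : (p + q).2 = p.2 + q.2 := rfl
  rcases hp with ⟨hp0, hp⟩ | ⟨hp0, γ, hγ, hp⟩ | ⟨hp0, γ, hγ, hp⟩ <;>
  rcases hq with ⟨hq0, hq⟩ | ⟨hq0, γ', hγ', hq⟩ | ⟨hq0, γ', hγ', hq⟩
  · exact Or.inl ⟨by rw [e1, hp0, hq0, add_zero], e2 ▸ add_nonneg hp hq⟩
  · refine Or.inr (Or.inl ⟨by omega, γ', hγ', ?_⟩)
    rw [e1, e2, hp0, zero_add, add_left_comm]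
    exact add_nonneg hp hq
  · refine Or.inr (Or.inr ⟨by omega, γ', hγ', ?_⟩)
    rw [e1, e2, hp0, zero_add, add_left_comm]
    exact add_nonneg hp hq
  · refine Or.inr (Or.inl ⟨by omega, γ, hγ, ?_⟩)
    rw [e1, e2, hq0, add_zero, ← add_assoc]
    exact add_nonneg hp hq
  · refine Or.inr (Or.inl ⟨by omega, max γ γ', ?_, ?_⟩)
    · rcases max_choice γ γ' with h | h <;> rw [h] <;> assumption
    · have h1 := zsmul_le_zsmul_right hp0.le (le_max_left γ γ')
      have h2 := zsmul_le_zsmul_right hq0.le (le_max_right γ γ')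
      rw [e1, e2, add_zsmul]
      calc (0 : Γ) ≤ (p.1 • γ + p.2) + (q.1 • γ' + q.2) := add_nonneg hp hq
        _ ≤ (p.1 • max γ γ' + p.2) + (q.1 • max γ γ' + q.2) := by
          exact add_le_add (add_le_add_left h1 _) (add_le_add_left h2 _)
        _ = _ := by abel
  · exact nonneg_add_aux hp0 hγ hp hq0 hγ' hq
  · refine Or.inr (Or.inr ⟨by omega, γ, hγ, ?_⟩)
    rw [e1, e2, hq0, add_zero, ← add_assoc]
    exact add_nonneg hp hq
  · rw [add_comm]
    exact nonneg_add_aux hq0 hγ' hq hp0 hγ hp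
  · refine Or.inr (Or.inr ⟨by omega, min γ γ', ?_, ?_⟩)
    · rcases min_choice γ γ' with h | h <;> rw [h] <;> assumption
    · have h1 := zsmul_le_zsmul_right (show (0:ℤ) ≤ -p.1 by omega) (min_le_left γ γ')
      have h2 := zsmul_le_zsmul_right (show (0:ℤ) ≤ -q.1 by omega) (min_le_right γ γ')
      rw [neg_zsmul, neg_zsmul, neg_le_neg_iff] at h1 h2
      rw [e1, e2, add_zsmul]
      calc (0 : Γ) ≤ (p.1 • γ + p.2) + (q.1 • γ' + q.2) := add_nonneg hp hq
        _ ≤ (p.1 • min γ γ' + p.2) + (q.1 • min γ γ' + q.2) := by gcongr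
        _ = _ := by abel

theorem CutGroup.not_nonneg_neg {p : CutGroup δ hΓ} (hp0 : 0 < p.1) (hp : p.Nonneg) :
    ¬ (-p).Nonneg := by
  have e1 : (-p).1 = -p.1 := rfl
  have e2 : (-p).2 = -p.2 := rfl
  intro hn
  rcases hp with ⟨h, -⟩ | ⟨-, γ, hγ, hp⟩ | ⟨h, -⟩
  · omega
  · rcases hn with ⟨h, -⟩ | ⟨h, -⟩ | ⟨-, γ', hγ', hn⟩
    · omega
    · omega
    · rw [e1, e2, neg_zsmul, ← neg_add, neg_nonneg] at hn
      have h3 := zsmul_lt_zsmul_right hp0 (δ.lt γ hγ γ' hγ')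
      exact absurd (lt_of_lt_of_le (add_lt_add_left h3 p.2) hn) (not_lt.2 hp)
  · omega

theorem CutGroup.eq_zero_of_nonneg {p : CutGroup δ hΓ} (hp : p.Nonneg) (hn : (-p).Nonneg) :
    p = 0 := by
  have e1 : (-p).1 = -p.1 := rfl
  have e2 : (-p).2 = -p.2 := rfl
  rcases lt_trichotomy p.1 0 with h0 | h0 | h0
  · exact absurd (by simpa using hp) (not_nonneg_neg (p := -p) (by omega) hn)
  · rcases hp with ⟨-, hp⟩ | ⟨h, -⟩ | ⟨h, -⟩
    · rcases hn with ⟨-, hn⟩ | ⟨h, -⟩ | ⟨h, -⟩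
      · rw [e2, neg_nonneg] at hn
        exact Prod.ext h0 (le_antisymm hn hp)
      · omega
      · omega
    · omega
    · omega
  · exact absurd hn (not_nonneg_neg h0 hp)

theorem CutGroup.nonneg_total (p : CutGroup δ hΓ) : p.Nonneg ∨ (-p).Nonneg := by
  have e1 : (-p).1 = -p.1 := rfl
  have e2 : (-p).2 = -p.2 := rfl
  rcases lt_trichotomy p.1 0 with h0 | h0 | h0
  · have := nonneg_total_aux (-p) (by omega)
    rw [neg_neg] at this
    exact this.symm
  · rcases le_total 0 p.2 with h | h
    · exact Or.inl (Or.inl ⟨h0, h⟩)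
    · exact Or.inr (Or.inl ⟨by omega, by rw [e2]; exact neg_nonneg.2 h⟩)
  · exact nonneg_total_aux p h0

/-- The nonnegative elements of `Γ(δ)`. -/
def CutGroup.cone (δ : Cut Γ) (hΓ : IsDivisible Γ) : AddGroupCone (CutGroup δ hΓ) where
  carrier := {p | p.Nonneg}
  add_mem' := CutGroup.nonneg_add
  zero_mem' := Or.inl ⟨rfl, le_rfl⟩
  eq_zero_of_mem_of_neg_mem' := CutGroup.eq_zero_of_nonneg

instance : HasMemOrNegMem (CutGroup.cone δ hΓ) := ⟨fun p => CutGroup.nonneg_total p⟩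

open Classical in
noncomputable instance : LinearOrder (CutGroup δ hΓ) :=
  LinearOrder.mkOfAddGroupCone (CutGroup.cone δ hΓ)

instance : IsOrderedAddMonoid (CutGroup δ hΓ) := IsOrderedAddMonoid.mkOfCone (CutGroup.cone δ hΓ)

theorem CutGroup.le_def (p q : CutGroup δ hΓ) : p ≤ q ↔ (q - p).Nonneg := Iff.rfl

/-- The inclusion `Γ → Γ(δ)`. -/
def CutGroup.incl (δ : Cut Γ) (hΓ : IsDivisible Γ) : Γ →+ CutGroup δ hΓ where
  toFun γ := ((0, γ) : ℤ × Γ)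
  map_zero' := rfl
  map_add' _ _ := Prod.ext (zero_add _).symm rfl

/-- The element `x_δ` of `Γ(δ)`. -/
def CutGroup.x (δ : Cut Γ) (hΓ : IsDivisible Γ) : CutGroup δ hΓ := ((1, 0) : ℤ × Γ)

theorem CutGroup.incl_le_incl {γ γ' : Γ} :
    CutGroup.incl δ hΓ γ ≤ CutGroup.incl δ hΓ γ' ↔ γ ≤ γ' := by
  rw [le_def, ← map_sub]
  constructor
  · rintro (⟨-, h⟩ | ⟨h, -⟩ | ⟨h, -⟩)
    · exact sub_nonneg.1 h
    · exact absurd h (lt_irrefl _)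
    · exact absurd h (lt_irrefl _)
  · exact fun h => Or.inl ⟨rfl, sub_nonneg.2 h⟩

theorem CutGroup.incl_lt_x {γ : Γ} (h : γ ∈ δ.L) : CutGroup.incl δ hΓ γ < CutGroup.x δ hΓ := by
  refine lt_of_le_of_ne ((le_def _ _).2 (Or.inr (Or.inl ⟨?_, γ, h, ?_⟩))) ?_
  · exact zero_lt_one
  · change 0 ≤ (1 - 0 : ℤ) • γ + (0 - γ)
    simp
  · exact fun h => zero_ne_one (congrArg Prod.fst h)

theorem CutGroup.x_lt_incl {γ : Γ} (h : γ ∈ δ.R) : CutGroup.x δ hΓ < CutGroup.incl δ hΓ γ := by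
  refine lt_of_le_of_ne ((le_def _ _).2 (Or.inr (Or.inr ⟨?_, γ, h, ?_⟩))) ?_
  · exact neg_one_lt_zero
  · change 0 ≤ (0 - 1 : ℤ) • γ + (γ - 0)
    simp
  · exact fun h => one_ne_zero (congrArg Prod.fst h)

end Cuts

section Balls

variable {L : Type*} [Field L] {Δ : Type*} [AddCommGroup Δ] [LinearOrder Δ] [IsOrderedAddMonoid Δ]
  (w : AddValuation L (WithTop Δ))

/-- The closed ball `B(a, γ)` in the valued field `(L, w)`. -/
def closedBall (a : L) (γ : Δ) : Set L := {c | (γ : WithTop Δ) ≤ w (c - a)}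

/-- The open ball `B°(a, γ)` in the valued field `(L, w)`. -/
def openBall (a : L) (γ : Δ) : Set L := {c | (γ : WithTop Δ) < w (c - a)}

/-- The ball `B(a, δ)` whose radius is a cut `δ`: all `c` with `w (c - a) > δ^L`. -/
def cutBall (a : L) (δ : Cut Δ) : Set L := {c | ∀ γ ∈ δ.L, (γ : WithTop Δ) < w (c - a)}

/-- The closure of a family of balls: all balls (open or closed) containing a member of it. -/
def ballClosure (F : Set (Set L)) : Set (Set L) :=
  {B | (∃ a γ, B = closedBall w a γ ∨ B = openBall w a γ) ∧ ∃ C ∈ F, C ⊆ B}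

/-- Nests of balls (open or closed). -/
def IsNest (F : Set (Set L)) : Prop :=
  (∀ B ∈ F, ∃ a γ, B = closedBall w a γ ∨ B = openBall w a γ) ∧ IsChain (· ⊆ ·) F

/-- Approximation types: the empty set, and the nests of balls equal to their closure. -/
def ApproxType : Type _ := {A : Set (Set L) // A = ∅ ∨ (IsNest w A ∧ ballClosure w A = A)}

/-- Approximation types are ordered by inclusion. -/
instance : PartialOrder (ApproxType w) := inferInstanceAs (PartialOrder (Subtype _))

/-- The support of an approximation type: the radii of the closed balls in it. -/
def supp (A : Set (Set L)) : Set Δ := {γ | ∃ a, closedBall w a γ ∈ A}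

/-- Immediate approximation types. -/
def IsImmediate (A : Set (Set L)) : Prop := A ≠ ∅ ∧ ⋂₀ A = ∅

/-- Value-extending approximation types. -/
def IsValueExtending (A : Set (Set L)) : Prop :=
  A = ∅ ∨ ((⋂₀ A).Nonempty ∧ ∀ γ ∈ supp w A, ∃ a, openBall w a γ ∈ A)

/-- Residue-extending approximation types. -/
def IsResidueExtending (A : Set (Set L)) : Prop :=
  ∃ γ ∈ supp w A, ∀ a, openBall w a γ ∉ A

end Balls

section Space

variable {K Γ : Type u} [Field K] [AddCommGroup Γ] [LinearOrder Γ] [IsOrderedAddMonoid Γ]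
  (v : AddValuation K (WithTop Γ))

/-- Closed balls of `K` with radius in `Γ`. -/
def BGamma : Type u := {B : Set K // ∃ a γ, B = closedBall v a γ}

/-- Balls of `K` with a cut of `Γ` as radius. -/
def BCut : Type u := {B : Set K // ∃ a δ, B = cutBall v a δ}

/-- `B ≤ C` means `B ⊇ C`. -/
instance : LE (BGamma v) := ⟨fun B C => C.1 ⊆ B.1⟩

/-- `B ≤ C` means `B ⊇ C`. -/
instance : LE (BCut v) := ⟨fun B C => C.1 ⊆ B.1⟩

/-- Nests of closed balls of `K` with radii in `Γ` and with empty intersection. -/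
structure NestInf where
  balls : Set (Set K)
  isClosedBall : ∀ B ∈ balls, ∃ a γ, B = closedBall v a γ
  chain : IsChain (· ⊆ ·) balls
  inter : ⋂₀ balls = ∅

/-- Mutual cofinality of nests. -/
instance NestInf.setoid : Setoid (NestInf v) where
  r 𝓑 𝓒 := (∀ B ∈ 𝓑.balls, ∃ C ∈ 𝓒.balls, C ⊆ B) ∧ (∀ C ∈ 𝓒.balls, ∃ B ∈ 𝓑.balls, B ⊆ C)
  iseqv :=
    { refl := fun _ => ⟨fun B hB => ⟨B, hB, subset_rfl⟩, fun B hB => ⟨B, hB, subset_rfl⟩⟩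
      symm := fun h => ⟨h.2, h.1⟩
      trans := fun {_ _ _} h h' =>
        ⟨fun B hB => by
          obtain ⟨C, hC, hCB⟩ := h.1 B hB
          obtain ⟨D, hD, hDC⟩ := h'.1 C hC
          exact ⟨D, hD, hDC.trans hCB⟩,
        fun D hD => by
          obtain ⟨C, hC, hCD⟩ := h'.2 D hD
          obtain ⟨B, hB, hBC⟩ := h.2 C hC
          exact ⟨B, hB, hBC.trans hCD⟩⟩ }

/-- Nests with empty intersection up to mutual cofinality. -/
def BInf : Type u := Quotient (NestInf.setoid v)

/-- Distinct classes of nests are not comparable. -/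
instance : LE (BInf v) := ⟨Eq⟩

/-- Pointed balls `(B(a, δ), δ)` with `δ` a quasi-cut, that is, either `δ = γ ∈ Γ` or `δ` a cut.
The radius is determined by the ball and by the kind of the radius. -/
inductive PointedBall
  | res (B : BGamma v) : PointedBall
  | cut (B : BCut v) : PointedBall

variable {v} in
/-- The underlying ball. -/
def PointedBall.under : PointedBall v → Set K
  | res B => B.1
  | cut B => B.1

variable {v} in
/-- The quasi-cut `δ` is the radius of the pointed ball. -/
def PointedBall.HasRadius : PointedBall v → QCut Γ → Prop
  | res B, δ => ∃ a γ, B.1 = closedBall v a γ ∧ δ = QCut.principal γ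
  | cut B, δ => ∃ a ε, B.1 = cutBall v a ε ∧ δ = ε.toQCut

/-- `(B, δ) ≤ (C, ε)` means `B ⊇ C` and `δ ≤ ε`. -/
instance : LE (PointedBall v) :=
  ⟨fun P Q => Q.under ⊆ P.under ∧ ∃ δ ε, P.HasRadius δ ∧ Q.HasRadius ε ∧ δ ≤ ε⟩

/-- The space `𝔹`, the disjoint union of `BInf`, `BGamma` and `BCut`. -/
inductive BSpace
  | nest (x : BInf v) : BSpace
  | ball (P : PointedBall v) : BSpace

variable {v} in
/-- The order of `𝔹`: classes of nests are maximal, and a pointed ball lies below a class of nests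
if its underlying ball contains some ball of the nest. -/
def BSpace.le : BSpace v → BSpace v → Prop
  | nest x, nest y => x ≤ y
  | nest _, ball _ => False
  | ball P, nest y => ∃ 𝓑 : NestInf v, Quotient.mk _ 𝓑 = y ∧ ∃ B ∈ 𝓑.balls, B ⊆ P.under
  | ball P, ball Q => P ≤ Q

instance : LE (BSpace v) := ⟨BSpace.le⟩

/-- The valuations on `K(x)`, with arbitrary value group, whose restriction to `K` is equivalent
to `v`. -/
structure Extension where
  Λ : Type u
  [group : AddCommGroup Λ]
  [order : LinearOrder Λ]
  [ordered : IsOrderedAddMonoid Λ]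
  val : AddValuation (RatFunc K) (WithTop Λ)
  restrict : (val.comap (algebraMap K (RatFunc K))).IsEquiv v

attribute [instance] Extension.group Extension.order Extension.ordered

/-- Equivalence of valuations. -/
instance Extension.setoid : Setoid (Extension v) where
  r E F := E.val.IsEquiv F.val
  iseqv := ⟨fun _ => .refl, fun h => h.symm, fun h h' => h.trans h'⟩

/-- The set `𝕍` of equivalence classes of valuations on `K(x)` whose restriction to `K` is
equivalent to `v`. -/
def VSpace : Type (u + 1) := Quotient (Extension.setoid v)

variable {v}

/-- The approximation type of `x` over `(K, v)`: the nonempty traces `B ∩ K` of the balls `B`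
of `K(x)` that are centred at `x` and have a radius in the value group of `K`. -/
def Extension.appr (E : Extension v) : Set (Set K) :=
  {S | S.Nonempty ∧ ∃ r : E.Λ, (∃ d : K, E.val (algebraMap K (RatFunc K) d) = r) ∧
    (S = algebraMap K (RatFunc K) ⁻¹' closedBall E.val RatFunc.X r ∨
     S = algebraMap K (RatFunc K) ⁻¹' openBall E.val RatFunc.X r)}

theorem Extension.appr_subset {E F : Extension v} (h : E.val.IsEquiv F.val) :
    E.appr ⊆ F.appr := by
  have hle : ∀ f g, E.val f ≤ E.val g ↔ F.val f ≤ F.val g := fun f g => h g f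
  have hlt : ∀ f g, E.val f < E.val g ↔ F.val f < F.val g := fun f g => by
    rw [← not_le, ← not_le, hle]
  rintro S ⟨hS, r, ⟨d, hd⟩, h1⟩
  have hdF : F.val (algebraMap K (RatFunc K) d) ≠ ⊤ :=
    h.ne_top.1 (by rw [hd]; exact WithTop.coe_ne_top)
  obtain ⟨s, hs⟩ := WithTop.ne_top_iff_exists.1 hdF
  refine ⟨hS, s, ⟨d, hs.symm⟩, h1.imp (fun h1 => ?_) (fun h1 => ?_)⟩
  · rw [h1]
    ext c
    simp only [closedBall, Set.mem_preimage, Set.mem_ofPred_eq, ← hd, hs, hle]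
  · rw [h1]
    ext c
    simp only [openBall, Set.mem_preimage, Set.mem_ofPred_eq, ← hd, hs, hlt]

/-- The map `ν ↦ appr_ν(x, K)` on classes of valuations. -/
def VSpace.appr : VSpace v → Set (Set K) :=
  Quotient.lift Extension.appr fun _ _ h =>
    Set.Subset.antisymm (Extension.appr_subset h) (Extension.appr_subset h.symm)

/-- The class in `𝕍` of the extension to `K(x)` of a valuation on `K[x]` with trivial support. -/
noncomputable def VSpace.mk {Λ : Type u} [AddCommGroup Λ] [LinearOrder Λ] [IsOrderedAddMonoid Λ]
    (w : AddValuation K[X] (WithTop Λ)) (hw : ∀ f, w f = ⊤ → f = 0)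
    (hv : ∀ c d, w (C c) ≤ w (C d) ↔ v c ≤ v d) : VSpace v :=
  Quotient.mk _
    { Λ := Λ
      val := extendRatFunc w hw
      restrict := fun c d => by
        have key : ∀ e : K, extendRatFunc w hw (algebraMap K (RatFunc K) e) = w (C e) := fun e => by
          rw [IsScalarTower.algebraMap_apply K K[X] (RatFunc K), extendRatFunc_algebraMap]
          rfl
        change extendRatFunc w hw (algebraMap K (RatFunc K) d)
          ≤ extendRatFunc w hw (algebraMap K (RatFunc K) c) ↔ v d ≤ v c
        rw [key, key, hv] }

/-- The class of the monomial valuation `ω_{a, γ}`, for `γ ∈ Γ`. -/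
noncomputable def omegaGamma (v : AddValuation K (WithTop Γ)) (a : K) (γ : Γ) : VSpace v :=
  VSpace.mk (monomialVal v a γ) (fun _ => monomialVal_eq_top)
    (fun c d => by rw [monomialVal_C, monomialVal_C])

theorem isDivisible [IsAlgClosed K] (hv : ∀ γ : Γ, ∃ c : K, v c = γ) : IsDivisible Γ := by
  intro n hn γ
  obtain ⟨c, hc⟩ := hv γ
  obtain ⟨d, hd⟩ := IsAlgClosed.exists_pow_nat_eq c (Nat.pos_of_ne_zero hn)
  have h1 : n • v d = (γ : WithTop Γ) := by rw [← AddValuation.map_pow, hd, hc]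
  have h2 : v d ≠ ⊤ := by
    intro h
    have hd0 : d = 0 := (AddValuation.top_iff v).1 h
    have hc0 : c = 0 := by rw [← hd, hd0, zero_pow hn]
    rw [hc0, AddValuation.map_zero] at hc
    exact WithTop.top_ne_coe hc
  obtain ⟨γ', hγ'⟩ := WithTop.ne_top_iff_exists.1 h2
  refine ⟨γ', ?_⟩
  rw [← hγ', ← WithTop.coe_nsmul] at h1
  exact WithTop.coe_injective h1

/-- The valuation `v`, regarded as taking values in `Γ(δ)`. -/
noncomputable def baseCut (v : AddValuation K (WithTop Γ)) (δ : Cut Γ) (hΓ : IsDivisible Γ) :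
    AddValuation K (WithTop (CutGroup δ hΓ)) :=
  v.map (CutGroup.incl δ hΓ).withTopMap rfl
    (Monotone.withTop_map fun _ _ h => CutGroup.incl_le_incl.2 h)

theorem baseCut_le (δ : Cut Γ) (hΓ : IsDivisible Γ) (c d : K) :
    baseCut v δ hΓ c ≤ baseCut v δ hΓ d ↔ v c ≤ v d := by
  change WithTop.map (CutGroup.incl δ hΓ) (v c) ≤ WithTop.map (CutGroup.incl δ hΓ) (v d) ↔ _
  exact WithTop.map_le_iff _ CutGroup.incl_le_incl

/-- The class of the monomial valuation `ω_{a, δ}`, for a cut `δ`. -/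
noncomputable def omegaCut (v : AddValuation K (WithTop Γ)) (hΓ : IsDivisible Γ) (a : K)
    (δ : Cut Γ) : VSpace v :=
  VSpace.mk (monomialVal (baseCut v δ hΓ) a (CutGroup.x δ hΓ)) (fun _ => monomialVal_eq_top)
    (fun c d => by rw [monomialVal_C, monomialVal_C, baseCut_le])

theorem le_of_closedBall_subset (hv : ∀ γ : Γ, ∃ c : K, v c = γ) {a b : K} {γ ε : Γ}
    (h : closedBall v b ε ⊆ closedBall v a γ) : γ ≤ ε ∧ (γ : WithTop Γ) ≤ v (b - a) := by
  have hb : (γ : WithTop Γ) ≤ v (b - a) := h (by simp [closedBall])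
  refine ⟨?_, hb⟩
  obtain ⟨c, hc⟩ := hv ε
  have h1 : (γ : WithTop Γ) ≤ v (b + c - a) := h (by simp [closedBall, hc])
  have h2 := v.map_le_sub h1 hb
  rw [show b + c - a - (b - a) = c by ring, hc] at h2
  exact WithTop.coe_le_coe.1 h2

theorem monomialVal_le_of_subset (hv : ∀ γ : Γ, ∃ c : K, v c = γ) {a b : K} {γ ε : Γ}
    (h : closedBall v b ε ⊆ closedBall v a γ) (f : K[X]) :
    monomialVal v a γ f ≤ monomialVal v b ε f :=
  monomialVal_mono (le_of_closedBall_subset hv h).1 (le_of_closedBall_subset hv h).2 f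

theorem omegaGamma_congr (hv : ∀ γ : Γ, ∃ c : K, v c = γ) {a b : K} {γ ε : Γ}
    (h : closedBall v a γ = closedBall v b ε) : omegaGamma v a γ = omegaGamma v b ε := by
  have hval : monomialVal v a γ = monomialVal v b ε :=
    AddValuation.ext fun f => le_antisymm (monomialVal_le_of_subset hv h.ge f)
      (monomialVal_le_of_subset hv h.le f)
  unfold omegaGamma
  simp only [hval]

theorem subset_of_cutBall_subset (hv : ∀ γ : Γ, ∃ c : K, v c = γ) {a b : K} {δ ε : Cut Γ}
    (h : cutBall v b ε ⊆ cutBall v a δ) : δ.L ⊆ ε.L := by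
  intro γ hγ
  by_contra hγε
  have hb : b ∈ cutBall v a δ := h (fun _ _ => by simp)
  obtain ⟨c, hc⟩ := hv γ
  have h1 : b + c ∈ cutBall v b ε := fun α hα => by
    rw [add_sub_cancel_left, hc]
    exact WithTop.coe_lt_coe.2 (ε.lt α hα γ ((ε.mem_R_iff γ).2 hγε))
  have h2 := v.map_lt_add (h h1 γ hγ) (show (γ : WithTop Γ) < v (-(b - a)) by
    rw [AddValuation.map_neg]; exact hb γ hγ)
  rw [show b + c - a + -(b - a) = c by ring, hc] at h2
  exact lt_irrefl _ h2

theorem x_le_of_mem_cutBall {hΓ : IsDivisible Γ} {a b : K} {δ : Cut Γ}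
    (h : b ∈ cutBall v a δ) :
    (CutGroup.x δ hΓ : WithTop (CutGroup δ hΓ)) ≤ baseCut v δ hΓ (b - a) := by
  change _ ≤ WithTop.map (CutGroup.incl δ hΓ) (v (b - a))
  rcases h0 : v (b - a) with _ | γ
  · exact le_top
  · have hγ : γ ∈ δ.R := (δ.mem_R_iff γ).2 fun hL => by
      have h1 := h γ hL
      rw [h0] at h1
      exact lt_irrefl _ h1
    exact WithTop.coe_le_coe.2 (CutGroup.x_lt_incl hγ).le

theorem omegaCut_congr (hv : ∀ γ : Γ, ∃ c : K, v c = γ) (hΓ : IsDivisible Γ) {a b : K}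
    {δ ε : Cut Γ} (h : cutBall v a δ = cutBall v b ε) :
    omegaCut v hΓ a δ = omegaCut v hΓ b ε := by
  obtain rfl : δ = ε := Cut.ext_L (Set.Subset.antisymm (subset_of_cutBall_subset hv h.ge)
    (subset_of_cutBall_subset hv h.le))
  have hb : b ∈ cutBall v a δ := h.ge (fun _ _ => by simp)
  have ha : a ∈ cutBall v b δ := h.le (fun _ _ => by simp)
  have hval : monomialVal (baseCut v δ hΓ) a (CutGroup.x δ hΓ)
      = monomialVal (baseCut v δ hΓ) b (CutGroup.x δ hΓ) :=
    AddValuation.ext fun f => le_antisymm (monomialVal_mono le_rfl (x_le_of_mem_cutBall hb) f)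
      (monomialVal_mono le_rfl (x_le_of_mem_cutBall ha) f)
  unfold omegaCut
  simp only [hval]

theorem NestInf.exists_lower (𝓑 : NestInf v) {B C : Set K} (hB : B ∈ 𝓑.balls)
    (hC : C ∈ 𝓑.balls) : ∃ D ∈ 𝓑.balls, D ⊆ B ∧ D ⊆ C := by
  rcases 𝓑.chain.total hB hC with h | h
  · exact ⟨B, hB, subset_rfl, h⟩
  · exact ⟨C, hC, h, subset_rfl⟩

theorem NestInf.exists_notMem (𝓑 : NestInf v) (b : K) : ∃ B ∈ 𝓑.balls, b ∉ B := by
  by_contra! h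
  have : b ∈ ⋂₀ 𝓑.balls := Set.mem_sInter.2 h
  rw [𝓑.inter] at this
  exact this

/-- The values `ω_B(f)` become constant, equal to `m`, for sufficiently small `B ∈ 𝓑`. -/
def NestInf.StableValue (𝓑 : NestInf v) (f : K[X]) (m : WithTop Γ) : Prop :=
  ∃ B ∈ 𝓑.balls, ∀ a γ, closedBall v a γ ∈ 𝓑.balls → closedBall v a γ ⊆ B →
    monomialVal v a γ f = m

theorem NestInf.stable_C (𝓑 : NestInf v) (c : K) : 𝓑.StableValue (C c) (v c) := by
  obtain ⟨B, hB, -⟩ := 𝓑.exists_notMem 0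
  exact ⟨B, hB, fun a γ _ _ => monomialVal_C v a γ c⟩

theorem NestInf.stable_linear (𝓑 : NestInf v) (b : K) :
    ∃ m, m ≠ ⊤ ∧ 𝓑.StableValue (X - C b) m := by
  obtain ⟨B, hB, hb⟩ := 𝓑.exists_notMem b
  obtain ⟨a₀, γ₀, rfl⟩ := 𝓑.isClosedBall B hB
  have hb' : v (b - a₀) < γ₀ := not_le.1 hb
  refine ⟨v (b - a₀), (hb'.trans (WithTop.coe_lt_top _)).ne, _, hB, fun a γ _ hsub => ?_⟩
  have ha : (γ₀ : WithTop Γ) ≤ v (a - a₀) := hsub (by simp [closedBall])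
  have hbγ : v (b - a) < γ := not_le.1 fun h => hb (hsub h)
  have hba : v (b - a) = v (b - a₀) := by
    rw [show b - a = (b - a₀) - (a - a₀) by ring]
    exact v.map_sub_eq_of_lt_left (hb'.trans_le ha)
  rw [monomialVal_linear, min_eq_left hbγ.le, hba]

theorem NestInf.stable_mul (𝓑 : NestInf v) {f g : K[X]} {m n : WithTop Γ}
    (hf : 𝓑.StableValue f m) (hg : 𝓑.StableValue g n) : 𝓑.StableValue (f * g) (m + n) := by
  obtain ⟨B, hB, hf⟩ := hf
  obtain ⟨B', hB', hg⟩ := hg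
  obtain ⟨D, hD, h1, h2⟩ := 𝓑.exists_lower hB hB'
  refine ⟨D, hD, fun a γ ha hs => ?_⟩
  rw [AddValuation.map_mul, hf a γ ha (hs.trans h1), hg a γ ha (hs.trans h2)]

theorem NestInf.exists_stable [IsAlgClosed K] (𝓑 : NestInf v) (f : K[X]) :
    ∃ m, 𝓑.StableValue f m := by
  rw [(IsAlgClosed.splits f).eq_prod_roots]
  have hprod : ∀ s : Multiset K, ∃ m, 𝓑.StableValue (s.map fun a => X - C a).prod m := by
    intro s
    induction s using Multiset.induction with
    | empty =>
      have := 𝓑.stable_C 1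
      rw [C_1] at this
      exact ⟨_, by simpa using this⟩
    | cons b s ih =>
      obtain ⟨m, hm⟩ := ih
      obtain ⟨n, -, hn⟩ := 𝓑.stable_linear b
      exact ⟨n + m, by simpa using 𝓑.stable_mul hn hm⟩
  obtain ⟨m, hm⟩ := hprod f.roots
  exact ⟨_, 𝓑.stable_mul (𝓑.stable_C _) hm⟩

/-- The set of values `ω_B(f)` with `B ∈ 𝓑`. -/
def NestInf.values (𝓑 : NestInf v) (f : K[X]) : Set (WithTop Γ) :=
  {m | ∃ a γ, closedBall v a γ ∈ 𝓑.balls ∧ m = monomialVal v a γ f}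

theorem NestInf.isGreatest_of_stable (𝓑 : NestInf v) (hv : ∀ γ : Γ, ∃ c : K, v c = γ) {f : K[X]}
    {m : WithTop Γ} (h : 𝓑.StableValue f m) : IsGreatest (𝓑.values f) m := by
  obtain ⟨B, hB, h⟩ := h
  constructor
  · obtain ⟨a, γ, rfl⟩ := 𝓑.isClosedBall B hB
    exact ⟨a, γ, hB, (h a γ hB subset_rfl).symm⟩
  · rintro _ ⟨a, γ, ha, rfl⟩
    obtain ⟨D, hD, h1, h2⟩ := 𝓑.exists_lower ha hB
    obtain ⟨b, ε, rfl⟩ := 𝓑.isClosedBall D hD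
    rw [← h b ε hD h2]
    exact monomialVal_le_of_subset hv h1 f

variable [IsAlgClosed K]

theorem NestInf.exists_max (𝓑 : NestInf v) (hv : ∀ γ : Γ, ∃ c : K, v c = γ) (f : K[X]) :
    ∃ m, IsGreatest (𝓑.values f) m :=
  let ⟨m, hm⟩ := 𝓑.exists_stable f
  ⟨m, 𝓑.isGreatest_of_stable hv hm⟩

/-- `ω_𝓑(f) = max {ω_B(f) | B ∈ 𝓑}`. -/
noncomputable def NestInf.maxValue (𝓑 : NestInf v) (hv : ∀ γ : Γ, ∃ c : K, v c = γ) (f : K[X]) :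
    WithTop Γ :=
  (𝓑.exists_max hv f).choose

theorem NestInf.maxValue_spec (𝓑 : NestInf v) (hv : ∀ γ : Γ, ∃ c : K, v c = γ) (f : K[X]) :
    IsGreatest (𝓑.values f) (𝓑.maxValue hv f) :=
  (𝓑.exists_max hv f).choose_spec

theorem NestInf.stable_iff (𝓑 : NestInf v) (hv : ∀ γ : Γ, ∃ c : K, v c = γ) {f : K[X]}
    {m : WithTop Γ} : 𝓑.StableValue f m ↔ 𝓑.maxValue hv f = m := by
  obtain ⟨n, hn⟩ := 𝓑.exists_stable f
  have h : ∀ {k}, 𝓑.StableValue f k → 𝓑.maxValue hv f = k := fun hk =>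
    (𝓑.maxValue_spec hv f).unique (𝓑.isGreatest_of_stable hv hk)
  exact ⟨h, fun hm => by rwa [← hm, h hn]⟩

theorem NestInf.maxValue_C (𝓑 : NestInf v) (hv : ∀ γ : Γ, ∃ c : K, v c = γ) (c : K) :
    𝓑.maxValue hv (C c) = v c :=
  (𝓑.stable_iff hv).1 (𝓑.stable_C c)

/-- The valuation `ω_𝓑` on `K[x]`. -/
noncomputable def NestInf.valuation (𝓑 : NestInf v) (hv : ∀ γ : Γ, ∃ c : K, v c = γ) :
    AddValuation K[X] (WithTop Γ) :=
  AddValuation.of (𝓑.maxValue hv)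
    (by rw [← C_0, 𝓑.maxValue_C hv, AddValuation.map_zero])
    (by rw [← C_1, 𝓑.maxValue_C hv, AddValuation.map_one])
    (fun f g => by
      obtain ⟨B, hB, hf⟩ := (𝓑.stable_iff hv (f := f)).2 rfl
      obtain ⟨B', hB', hg⟩ := (𝓑.stable_iff hv (f := g)).2 rfl
      obtain ⟨D, hD, h1, h2⟩ := 𝓑.exists_lower hB hB'
      obtain ⟨a, γ, rfl⟩ := 𝓑.isClosedBall D hD
      rw [← hf a γ hD h1, ← hg a γ hD h2]
      exact ((monomialVal v a γ).map_add f g).trans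
        ((𝓑.maxValue_spec hv (f + g)).2 ⟨a, γ, hD, rfl⟩))
    (fun f g => (𝓑.stable_iff hv).1
      (𝓑.stable_mul ((𝓑.stable_iff hv).2 rfl) ((𝓑.stable_iff hv).2 rfl)))

theorem NestInf.valuation_eq_top (𝓑 : NestInf v) (hv : ∀ γ : Γ, ∃ c : K, v c = γ) (f : K[X])
    (h : 𝓑.valuation hv f = ⊤) : f = 0 := by
  obtain ⟨a, γ, -, hm⟩ := (𝓑.maxValue_spec hv f).1
  exact monomialVal_eq_top (hm.symm.trans h)

theorem NestInf.maxValue_le {𝓑 𝓒 : NestInf v} (hv : ∀ γ : Γ, ∃ c : K, v c = γ)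
    (h : ∀ B ∈ 𝓑.balls, ∃ C ∈ 𝓒.balls, C ⊆ B) (f : K[X]) :
    𝓑.maxValue hv f ≤ 𝓒.maxValue hv f := by
  obtain ⟨a, γ, hB, hm⟩ := (𝓑.maxValue_spec hv f).1
  obtain ⟨C, hC, hCB⟩ := h _ hB
  obtain ⟨b, ε, rfl⟩ := 𝓒.isClosedBall C hC
  rw [hm]
  exact (monomialVal_le_of_subset hv hCB f).trans ((𝓒.maxValue_spec hv f).2 ⟨b, ε, hC, rfl⟩)

/-- The class of the valuation `ω_𝓑`. -/
noncomputable def omegaNest (hv : ∀ γ : Γ, ∃ c : K, v c = γ) (𝓑 : NestInf v) : VSpace v :=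
  VSpace.mk (𝓑.valuation hv) (𝓑.valuation_eq_top hv) (fun c d => by
    change 𝓑.maxValue hv (C c) ≤ 𝓑.maxValue hv (C d) ↔ _
    rw [𝓑.maxValue_C, 𝓑.maxValue_C])

theorem omegaNest_congr (hv : ∀ γ : Γ, ∃ c : K, v c = γ) (𝓑 𝓒 : NestInf v) (h : 𝓑 ≈ 𝓒) :
    omegaNest hv 𝓑 = omegaNest hv 𝓒 := by
  have hval : 𝓑.valuation hv = 𝓒.valuation hv :=
    AddValuation.ext fun f => le_antisymm (NestInf.maxValue_le hv h.1 f)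
      (NestInf.maxValue_le hv h.2 f)
  unfold omegaNest
  simp only [hval]

variable (v) in
/-- The map `𝔹 → 𝕍`, `B ↦ ω_B`. The choice of a centre of a ball is immaterial by the two
lemmas that follow. -/
noncomputable def omega (hv : ∀ γ : Γ, ∃ c : K, v c = γ) : BSpace v → VSpace v
  | .nest x => Quotient.lift (omegaNest hv) (omegaNest_congr hv) x
  | .ball (.res B) => omegaGamma v B.2.choose B.2.choose_spec.choose
  | .ball (.cut B) => omegaCut v (isDivisible hv) B.2.choose B.2.choose_spec.choose

theorem omega_res (hv : ∀ γ : Γ, ∃ c : K, v c = γ) (a : K) (γ : Γ) :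
    omega v hv (.ball (.res ⟨closedBall v a γ, a, γ, rfl⟩)) = omegaGamma v a γ := by
  let B : BGamma v := ⟨closedBall v a γ, a, γ, rfl⟩
  exact omegaGamma_congr hv B.2.choose_spec.choose_spec.symm

theorem omega_cut (hv : ∀ γ : Γ, ∃ c : K, v c = γ) (a : K) (δ : Cut Γ) :
    omega v hv (.ball (.cut ⟨cutBall v a δ, a, δ, rfl⟩)) = omegaCut v (isDivisible hv) a δ := by
  let B : BCut v := ⟨cutBall v a δ, a, δ, rfl⟩
  exact omegaCut_congr hv _ B.2.choose_spec.choose_spec.symm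

end Space

end ValTree

namespace ValTree

open Polynomial

/-! An approximation type only sees the values of the linear polynomials `x - c`. If a ball of
`K(x)` around `x` contains some `c` in `K`, the ultrametric inequality makes its trace on `K` the
ball of the same radius around `c`. So `appr_ν` consists of the balls `B(c, γ)` with `ν(x - c) ≥ γ`
and `B°(c, γ)` with `ν(x - c) > γ`; `appr_mk_eq_ballClosure` turns this into a criterion for
`appr_ν` to be the closure of a given family. For a ball with centre `a` and radius `γ` or a cut
`δ`, `ω_B(x - c)` is the minimum of `v(a - c)` and `γ` or `x_δ`; for a nest it is the maximum of
such minima. The inequalities above then say exactly that a generator lies inside the ball in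
question, which gives the three explicit formulas.

What remains concerns balls of `K`. An inclusion of closures means that every generator of the first
contains a generator of the second. Comparing this with the order of `𝔹` for each of the nine pairs
of kinds gives `appr_omega_subset_iff`, and injectivity follows because the order of `𝔹` is
antisymmetric. Two points need care. A nest is not contained in the type of a ball, since some
member omits the centre, and nests are maximal (`subset_of_isNest_of_sInter_eq_empty`). A cut ball
may coincide as a set with a closed ball, and then only the radii tell them apart
(`resPoint_le_cutPoint`).

For surjectivity every approximation type is immediate, residue-extending or value-extending, and is
recovered from its closed balls, from one closed ball, or from a common point together with its
support (`ApproxType.exists_nest`, `ApproxType.exists_res`, `ApproxType.exists_cut`).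

Algebraic closedness makes `Γ` divisible, hence dense, so that the inclusion of an open ball in a
closed one compares their radii. -/

theorem Cut.mem_L_of_le {Γ : Type*} [LinearOrder Γ] {δ : Cut Γ} {γ ε : Γ} (h : γ ≤ ε) (hε : ε ∈ δ.L) : γ ∈ δ.L := by
  by_contra hγ
  exact absurd (δ.lt ε hε γ ((δ.mem_R_iff γ).2 hγ)) (not_lt.2 h)

/-! ### Inclusions between balls, and closures of families of balls. -/

section Balls

variable {L : Type*} [Field L] {Δ : Type*} [AddCommGroup Δ] [LinearOrder Δ] [IsOrderedAddMonoid Δ]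
  {w : AddValuation L (WithTop Δ)}

theorem mem_closedBall {a c : L} {γ : Δ} : c ∈ closedBall w a γ ↔ (γ : WithTop Δ) ≤ w (c - a) :=
  Iff.rfl

theorem mem_openBall {a c : L} {γ : Δ} : c ∈ openBall w a γ ↔ (γ : WithTop Δ) < w (c - a) :=
  Iff.rfl

theorem self_mem_closedBall (a : L) (γ : Δ) : a ∈ closedBall w a γ := by simp [mem_closedBall]

theorem self_mem_openBall (a : L) (γ : Δ) : a ∈ openBall w a γ := by simp [mem_openBall]

theorem self_mem_cutBall (a : L) (δ : Cut Δ) : a ∈ cutBall w a δ := fun γ _ => by simp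

theorem closedBall_eq_of_mem {a b : L} {γ : Δ} (h : b ∈ closedBall w a γ) :
    closedBall w a γ = closedBall w b γ := by
  have h : (γ : WithTop Δ) ≤ w (b - a) := h
  ext c
  constructor
  · intro hc
    have := w.map_le_sub hc h
    rwa [sub_sub_sub_cancel_right] at this
  · intro hc
    have := w.map_le_add hc h
    rwa [sub_add_sub_cancel] at this

theorem openBall_eq_of_mem {a b : L} {γ : Δ} (h : b ∈ openBall w a γ) :
    openBall w a γ = openBall w b γ := by
  have h : (γ : WithTop Δ) < w (b - a) := h
  have h' : (γ : WithTop Δ) < w (a - b) := by rwa [w.map_sub_swap]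
  ext c
  constructor
  · intro hc
    have := w.map_lt_add hc h'
    rwa [sub_add_sub_cancel] at this
  · intro hc
    have := w.map_lt_add hc h
    rwa [sub_add_sub_cancel] at this

/-- The midpoint: halve `ε - γ`. -/
theorem exists_between_of_isDivisible (hΔ : IsDivisible Δ) {γ ε : Δ} (h : γ < ε) :
    ∃ η, γ < η ∧ η < ε := by
  obtain ⟨τ, hτ⟩ := hΔ 2 two_ne_zero (ε - γ)
  have hpos : 0 < τ := by
    by_contra! hle
    have h1 : 2 • τ ≤ 0 := nsmul_nonpos hle 2
    rw [hτ] at h1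
    exact absurd (sub_nonpos.1 h1) (not_le.2 h)
  refine ⟨γ + τ, lt_add_of_pos_right γ hpos, ?_⟩
  have : ε = γ + τ + τ := by
    rw [add_assoc, ← two_nsmul, hτ]
    abel
  rw [this]
  exact lt_add_of_pos_right _ hpos

/-- A point at distance exactly `ε` from `b`, available because every radius is a value, detects the
comparison of radii. The inclusion lemmas that follow use the same test point, with its distance
adapted to the kinds of balls. -/
theorem closedBall_subset_closedBall (hw : ∀ γ : Δ, ∃ c : L, w c = γ) {a b : L} {γ ε : Δ} :
    closedBall w b ε ⊆ closedBall w a γ ↔ γ ≤ ε ∧ b ∈ closedBall w a γ := by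
  constructor
  · intro h
    have hb := h (self_mem_closedBall b ε)
    refine ⟨?_, hb⟩
    obtain ⟨c, hc⟩ := hw ε
    have h1 : b + c ∈ closedBall w a γ := h (by simp [mem_closedBall, hc])
    rw [closedBall_eq_of_mem hb, mem_closedBall, add_sub_cancel_left, hc] at h1
    exact WithTop.coe_le_coe.1 h1
  · rintro ⟨h, hb⟩ c hc
    rw [closedBall_eq_of_mem hb]
    exact (WithTop.coe_le_coe.2 h).trans hc

theorem closedBall_subset_openBall (hw : ∀ γ : Δ, ∃ c : L, w c = γ) {a b : L} {γ ε : Δ} :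
    closedBall w b ε ⊆ openBall w a γ ↔ γ < ε ∧ b ∈ openBall w a γ := by
  constructor
  · intro h
    have hb := h (self_mem_closedBall b ε)
    refine ⟨?_, hb⟩
    obtain ⟨c, hc⟩ := hw ε
    have h1 : b + c ∈ openBall w a γ := h (by simp [mem_closedBall, hc])
    rw [openBall_eq_of_mem hb, mem_openBall, add_sub_cancel_left, hc] at h1
    exact WithTop.coe_lt_coe.1 h1
  · rintro ⟨h, hb⟩ c hc
    rw [openBall_eq_of_mem hb]
    exact (WithTop.coe_lt_coe.2 h).trans_le hc

theorem openBall_subset_openBall (hw : ∀ γ : Δ, ∃ c : L, w c = γ) {a b : L} {γ ε : Δ} :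
    openBall w b ε ⊆ openBall w a γ ↔ γ ≤ ε ∧ b ∈ openBall w a γ := by
  constructor
  · intro h
    have hb := h (self_mem_openBall b ε)
    refine ⟨?_, hb⟩
    by_contra! hlt
    obtain ⟨c, hc⟩ := hw γ
    have h1 : b + c ∈ openBall w a γ := h (by simp [mem_openBall, hc, hlt])
    rw [openBall_eq_of_mem hb, mem_openBall, add_sub_cancel_left, hc] at h1
    exact lt_irrefl _ h1
  · rintro ⟨h, hb⟩ c hc
    rw [openBall_eq_of_mem hb]
    exact (WithTop.coe_le_coe.2 h).trans_lt hc

theorem openBall_subset_closedBall (hw : ∀ γ : Δ, ∃ c : L, w c = γ) (hΔ : IsDivisible Δ)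
    {a b : L} {γ ε : Δ} :
    openBall w b ε ⊆ closedBall w a γ ↔ γ ≤ ε ∧ b ∈ closedBall w a γ := by
  constructor
  · intro h
    have hb := h (self_mem_openBall b ε)
    refine ⟨?_, hb⟩
    by_contra! hlt
    -- Density is essential: if `γ` were the successor of `ε`, then `B°(b, ε) = B(b, γ)` and the
    -- inclusion would not force `γ ≤ ε`. A point at distance `η` from `b` lies in the open ball but
    -- not in the closed one.
    obtain ⟨η, h1, h2⟩ := exists_between_of_isDivisible hΔ hlt
    obtain ⟨c, hc⟩ := hw η
    have h3 : b + c ∈ closedBall w a γ := h (by simp [mem_openBall, hc, h1])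
    rw [closedBall_eq_of_mem hb, mem_closedBall, add_sub_cancel_left, hc] at h3
    exact absurd (WithTop.coe_le_coe.1 h3) (not_le.2 h2)
  · rintro ⟨h, hb⟩ c hc
    rw [closedBall_eq_of_mem hb]
    exact (WithTop.coe_le_coe.2 h).trans (le_of_lt hc)

theorem openBall_subset_closedBall_self (a : L) (γ : Δ) : openBall w a γ ⊆ closedBall w a γ :=
  fun _ hc => mem_closedBall.2 (le_of_lt (mem_openBall.1 hc))

theorem cutBall_subset_openBall {a : L} {δ : Cut Δ} {γ : Δ} (h : γ ∈ δ.L) :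
    cutBall w a δ ⊆ openBall w a γ := fun _ hc => hc γ h

variable (w) in
/-- Balls, open or closed, with radius in the value group. -/
def IsBall (B : Set L) : Prop := ∃ a γ, B = closedBall w a γ ∨ B = openBall w a γ

theorem isBall_closedBall (a : L) (γ : Δ) : IsBall w (closedBall w a γ) := ⟨a, γ, Or.inl rfl⟩

theorem isBall_openBall (a : L) (γ : Δ) : IsBall w (openBall w a γ) := ⟨a, γ, Or.inr rfl⟩

theorem IsBall.nonempty {B : Set L} (h : IsBall w B) : B.Nonempty := by
  obtain ⟨a, γ, rfl | rfl⟩ := h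
  · exact ⟨a, self_mem_closedBall a γ⟩
  · exact ⟨a, self_mem_openBall a γ⟩

theorem IsBall.eq_of_mem {B : Set L} (h : IsBall w B) {c : L} (hc : c ∈ B) :
    ∃ γ, B = closedBall w c γ ∨ B = openBall w c γ := by
  obtain ⟨a, γ, rfl | rfl⟩ := h
  · exact ⟨γ, Or.inl (closedBall_eq_of_mem hc)⟩
  · exact ⟨γ, Or.inr (openBall_eq_of_mem hc)⟩

/-- Recentre both balls at the common point; then only the radii and the kinds matter, an open ball
being the smaller one at equal radius. -/
theorem IsBall.subset_or_subset {B C : Set L} (hB : IsBall w B) (hC : IsBall w C) {c : L}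
    (hcB : c ∈ B) (hcC : c ∈ C) : B ⊆ C ∨ C ⊆ B := by
  obtain ⟨γ, rfl | rfl⟩ := hB.eq_of_mem hcB <;> obtain ⟨ε, rfl | rfl⟩ := hC.eq_of_mem hcC
  · exact (le_total ε γ).imp (fun h x hx => (WithTop.coe_le_coe.2 h).trans hx)
      (fun h x hx => (WithTop.coe_le_coe.2 h).trans hx)
  · exact (lt_or_ge ε γ).imp (fun h x hx => (WithTop.coe_lt_coe.2 h).trans_le hx)
      (fun h x hx => (WithTop.coe_le_coe.2 h).trans (le_of_lt hx))
  · exact (le_or_gt ε γ).imp (fun h x hx => (WithTop.coe_le_coe.2 h).trans (le_of_lt hx))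
      (fun h x hx => (WithTop.coe_lt_coe.2 h).trans_le hx)
  · exact (le_total ε γ).imp (fun h x hx => (WithTop.coe_le_coe.2 h).trans_lt hx)
      (fun h x hx => (WithTop.coe_le_coe.2 h).trans_lt hx)

theorem mem_ballClosure {F : Set (Set L)} {B : Set L} :
    B ∈ ballClosure w F ↔ IsBall w B ∧ ∃ C ∈ F, C ⊆ B := Iff.rfl

theorem ballClosure_subset_ballClosure {F G : Set (Set L)} (hF : ∀ B ∈ F, IsBall w B) :
    ballClosure w F ⊆ ballClosure w G ↔ ∀ B ∈ F, ∃ C ∈ G, C ⊆ B := by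
  constructor
  · exact fun h B hB => (h ⟨hF B hB, B, hB, subset_rfl⟩).2
  · rintro h B ⟨hB, C, hC, hCB⟩
    obtain ⟨D, hD, hDC⟩ := h C hC
    exact ⟨hB, D, hD, hDC.trans hCB⟩

theorem subset_ballClosure {F : Set (Set L)} (hF : ∀ B ∈ F, IsBall w B) :
    F ⊆ ballClosure w F := fun B hB => ⟨hF B hB, B, hB, subset_rfl⟩

theorem ballClosure_idem (F : Set (Set L)) : ballClosure w (ballClosure w F) = ballClosure w F :=
  Set.Subset.antisymm
    (fun _ ⟨hB, _, ⟨_, D, hD, hDC⟩, hCB⟩ => ⟨hB, D, hD, hDC.trans hCB⟩)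
    (subset_ballClosure fun _ hB => hB.1)

/-- Two balls of the closure share a point of the smaller of their two generators, hence are
comparable. -/
theorem isNest_ballClosure {F : Set (Set L)} (hF : ∀ B ∈ F, IsBall w B)
    (hc : IsChain (· ⊆ ·) F) : IsNest w (ballClosure w F) := by
  refine ⟨fun B hB => hB.1, ?_⟩
  rintro B ⟨hB, B', hB', hBB⟩ C ⟨hC, C', hC', hCC⟩ -
  rcases hc.total hB' hC' with h | h
  · obtain ⟨c, hcB⟩ := (hF B' hB').nonempty
    exact IsBall.subset_or_subset hB hC (hBB hcB) (hCC (h hcB))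
  · obtain ⟨c, hcC⟩ := (hF C' hC').nonempty
    exact IsBall.subset_or_subset hB hC (hBB (h hcC)) (hCC hcC)

theorem sInter_ballClosure {F : Set (Set L)} (hF : ∀ B ∈ F, IsBall w B) :
    ⋂₀ ballClosure w F = ⋂₀ F :=
  Set.Subset.antisymm (Set.sInter_subset_sInter (subset_ballClosure hF))
    (Set.subset_sInter fun _ ⟨_, _, hC, hCB⟩ => (Set.sInter_subset_of_mem hC).trans hCB)

end Balls

/-! ### Approximation types of the valuations `ω_B`. -/

section Trace

variable {K Γ : Type u} [Field K] [AddCommGroup Γ] [LinearOrder Γ] [IsOrderedAddMonoid Γ]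
  {v : AddValuation K (WithTop Γ)}

/-- Reduces the computation of an approximation type to the values of linear polynomials. A radius
enters through an element `d` realizing it, because `Γ` and the value group `Λ` of `w` are compared
only through `K`. -/
theorem appr_mk_eq_ballClosure {Λ : Type u} [AddCommGroup Λ] [LinearOrder Λ]
    [IsOrderedAddMonoid Λ] {w : AddValuation K[X] (WithTop Λ)} {hw : ∀ f, w f = ⊤ → f = 0}
    {hwv : ∀ c d, w (C c) ≤ w (C d) ↔ v c ≤ v d} (hv : ∀ γ : Γ, ∃ c : K, v c = γ)
    {F : Set (Set K)}
    (hc : ∀ c d (γ : Γ), v d = γ →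
      (w (C d) ≤ w (X - C c) ↔ ∃ B ∈ F, B ⊆ closedBall v c γ))
    (ho : ∀ c d (γ : Γ), v d = γ →
      (w (C d) < w (X - C c) ↔ ∃ B ∈ F, B ⊆ openBall v c γ)) :
    (VSpace.mk w hw hwv).appr = ballClosure v F := by
  have hlt : ∀ c d, w (C c) < w (C d) ↔ v c < v d := fun c d => by
    rw [← not_le, ← not_le, hwv]
  have hfin : ∀ d, w (C d) ≠ ⊤ ↔ v d ≠ ⊤ := fun d => by
    rw [not_iff_not]
    constructor
    · intro h
      rw [AddValuation.top_iff]
      exact C_eq_zero.1 (hw _ h)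
    · intro h
      rw [AddValuation.top_iff] at h
      rw [h, C_0, AddValuation.map_zero]
  have hC : ∀ d, algebraMap K (RatFunc K) d = algebraMap K[X] (RatFunc K) (C d) := fun d => by
    rw [IsScalarTower.algebraMap_apply K K[X] (RatFunc K)]
    rfl
  have hval : ∀ d, extendRatFunc w hw (algebraMap K (RatFunc K) d) = w (C d) := fun d => by
    rw [hC, extendRatFunc_algebraMap]
  have hX : ∀ c, extendRatFunc w hw (algebraMap K (RatFunc K) c - RatFunc.X) = w (X - C c) :=
    fun c => by
      rw [hC, ← RatFunc.algebraMap_X, ← map_sub, extendRatFunc_algebraMap, w.map_sub_swap]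
  have hXX : ∀ e c, w (C (e - c)) = w ((X - C c) - (X - C e)) := fun e c => by
    congr 1; rw [C_sub]; ring
  -- A trace containing `c` is a ball around `c`, since `e - c` is the difference of `x - c` and `x
  -- - e`. Likewise for open balls below.
  have hclosed : ∀ c d (γ : Γ), v d = γ → w (C d) ≤ w (X - C c) →
      {e | w (C d) ≤ w (X - C e)} = closedBall v c γ := fun c d γ hd h => by
    ext e
    rw [mem_closedBall, ← hd, ← hwv]
    constructor
    · intro he
      rw [hXX]
      exact w.map_le_sub h he
    · intro he
      have := w.map_le_sub h he
      rwa [show X - C c - C (e - c) = X - C e by rw [C_sub]; ring] at this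
  have hopen : ∀ c d (γ : Γ), v d = γ → w (C d) < w (X - C c) →
      {e | w (C d) < w (X - C e)} = openBall v c γ := fun c d γ hd h => by
    ext e
    rw [mem_openBall, ← hd, ← hlt]
    constructor
    · intro he
      rw [hXX, sub_eq_add_neg]
      exact w.map_lt_add h (by rwa [AddValuation.map_neg])
    · intro he
      have := w.map_lt_add h (show w (C d) < w (-C (e - c)) by rwa [AddValuation.map_neg])
      rwa [show X - C c + -C (e - c) = X - C e by rw [C_sub]; ring] at this
  have hmem : ∀ S, S ∈ (VSpace.mk w hw hwv).appr ↔ S.Nonempty ∧ ∃ r : Λ, (∃ d, w (C d) = r) ∧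
      (S = {e | (r : WithTop Λ) ≤ w (X - C e)} ∨ S = {e | (r : WithTop Λ) < w (X - C e)}) := by
    intro S
    simp only [← hval, ← hX]
    exact Iff.rfl
  ext S
  rw [hmem, mem_ballClosure]
  constructor
  · rintro ⟨⟨c, hcS⟩, r, ⟨d, hd⟩, h⟩
    -- The radius `r` in `Λ` is the value of `d`, and `γ` is the corresponding radius in `Γ`; `c` is
    -- any point of the trace.
    obtain ⟨γ, hγ⟩ := WithTop.ne_top_iff_exists.1 ((hfin d).1 (hd ▸ WithTop.coe_ne_top))
    rw [← hd] at h
    rcases h with rfl | rfl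
    · rw [hclosed c d γ hγ.symm hcS]
      exact ⟨isBall_closedBall c γ, (hc c d γ hγ.symm).1 hcS⟩
    · rw [hopen c d γ hγ.symm hcS]
      exact ⟨isBall_openBall c γ, (ho c d γ hγ.symm).1 hcS⟩
  · rintro ⟨⟨c, γ, h⟩, hF⟩
    obtain ⟨d, hd⟩ := hv γ
    obtain ⟨r, hr⟩ := WithTop.ne_top_iff_exists.1 ((hfin d).2 (hd ▸ WithTop.coe_ne_top))
    rcases h with rfl | rfl
    · refine ⟨⟨c, self_mem_closedBall c γ⟩, r, ⟨d, hr.symm⟩, Or.inl ?_⟩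
      rw [hr, hclosed c d γ hd ((hc c d γ hd).2 hF)]
    · refine ⟨⟨c, self_mem_openBall c γ⟩, r, ⟨d, hr.symm⟩, Or.inr ?_⟩
      rw [hr, hopen c d γ hd ((ho c d γ hd).2 hF)]

theorem appr_omegaGamma (hv : ∀ γ : Γ, ∃ c : K, v c = γ) (a : K) (γ : Γ) :
    (omegaGamma v a γ).appr = ballClosure v {closedBall v a γ} := by
  refine appr_mk_eq_ballClosure hv (fun c d ε hd => ?_) (fun c d ε hd => ?_)
  · rw [monomialVal_C, monomialVal_linear, hd, le_min_iff, WithTop.coe_le_coe]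
    simp only [Set.mem_singleton_iff, exists_eq_left, closedBall_subset_closedBall hv,
      mem_closedBall, v.map_sub_swap a c, and_comm]
  · rw [monomialVal_C, monomialVal_linear, hd, lt_min_iff, WithTop.coe_lt_coe]
    simp only [Set.mem_singleton_iff, exists_eq_left, closedBall_subset_openBall hv,
      mem_openBall, v.map_sub_swap a c, and_comm]

theorem CutGroup.incl_lt_x_iff {δ : Cut Γ} {hΓ : IsDivisible Γ} {γ : Γ} :
    CutGroup.incl δ hΓ γ < CutGroup.x δ hΓ ↔ γ ∈ δ.L := by
  refine ⟨fun h => ?_, CutGroup.incl_lt_x⟩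
  by_contra hγ
  exact lt_asymm h (CutGroup.x_lt_incl ((δ.mem_R_iff γ).2 hγ))

/-- As `x_δ` is not in `Γ`, the weak and the strict inequality agree. Thus open and closed balls
occur with the same radii in the type of a cut ball. -/
theorem CutGroup.incl_le_x_iff {δ : Cut Γ} {hΓ : IsDivisible Γ} {γ : Γ} :
    CutGroup.incl δ hΓ γ ≤ CutGroup.x δ hΓ ↔ γ ∈ δ.L := by
  refine ⟨fun h => ?_, fun h => (CutGroup.incl_lt_x h).le⟩
  by_contra hγ
  exact absurd (CutGroup.x_lt_incl ((δ.mem_R_iff γ).2 hγ)) (not_lt.2 h)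

/-- The open balls of radius in `δ^L` around `a`. -/
def openBallsBelow (v : AddValuation K (WithTop Γ)) (a : K) (δ : Cut Γ) : Set (Set K) :=
  {B | ∃ γ ∈ δ.L, B = openBall v a γ}

/-- Since `δ^L` is an initial segment, the open ball of radius `γ` itself serves as the generator.
-/
theorem exists_openBallsBelow_subset_closedBall (hv : ∀ γ : Γ, ∃ c : K, v c = γ)
    (hΓ : IsDivisible Γ) {a c : K} {δ : Cut Γ} {γ : Γ} :
    (∃ B ∈ openBallsBelow v a δ, B ⊆ closedBall v c γ) ↔ γ ∈ δ.L ∧ a ∈ closedBall v c γ := by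
  constructor
  · rintro ⟨_, ⟨ε, hε, rfl⟩, h⟩
    rw [openBall_subset_closedBall hv hΓ] at h
    exact ⟨Cut.mem_L_of_le h.1 hε, h.2⟩
  · rintro ⟨hγ, ha⟩
    exact ⟨_, ⟨γ, hγ, rfl⟩, (openBall_subset_closedBall hv hΓ).2 ⟨le_rfl, ha⟩⟩

theorem exists_openBallsBelow_subset_openBall (hv : ∀ γ : Γ, ∃ c : K, v c = γ)
    {a c : K} {δ : Cut Γ} {γ : Γ} :
    (∃ B ∈ openBallsBelow v a δ, B ⊆ openBall v c γ) ↔ γ ∈ δ.L ∧ a ∈ openBall v c γ := by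
  constructor
  · rintro ⟨_, ⟨ε, hε, rfl⟩, h⟩
    rw [openBall_subset_openBall hv] at h
    exact ⟨Cut.mem_L_of_le h.1 hε, h.2⟩
  · rintro ⟨hγ, ha⟩
    exact ⟨_, ⟨γ, hγ, rfl⟩, (openBall_subset_openBall hv).2 ⟨le_rfl, ha⟩⟩

theorem appr_omegaCut (hv : ∀ γ : Γ, ∃ c : K, v c = γ) (hΓ : IsDivisible Γ) (a : K) (δ : Cut Γ) :
    (omegaCut v hΓ a δ).appr = ballClosure v (openBallsBelow v a δ) := by
  have hb : ∀ d (ε : Γ), v d = ε →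
      baseCut v δ hΓ d = ((CutGroup.incl δ hΓ ε : CutGroup δ hΓ) : WithTop (CutGroup δ hΓ)) :=
    fun d ε hd => by
      change WithTop.map (CutGroup.incl δ hΓ) (v d) = _
      rw [hd]
      rfl
  have hlt : ∀ c d, baseCut v δ hΓ c < baseCut v δ hΓ d ↔ v c < v d := fun c d => by
    rw [← not_le, ← not_le, baseCut_le]
  refine appr_mk_eq_ballClosure hv (fun c d ε hd => ?_) (fun c d ε hd => ?_)
  · rw [monomialVal_C, monomialVal_linear, le_min_iff, baseCut_le, hb d ε hd, WithTop.coe_le_coe,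
      CutGroup.incl_le_x_iff, exists_openBallsBelow_subset_closedBall hv hΓ, mem_closedBall,
      v.map_sub_swap a c, hd, and_comm]
  · rw [monomialVal_C, monomialVal_linear, lt_min_iff, hlt, hb d ε hd, WithTop.coe_lt_coe,
      CutGroup.incl_lt_x_iff, exists_openBallsBelow_subset_openBall hv, mem_openBall,
      v.map_sub_swap a c, hd, and_comm]

theorem NestInf.exists_ball_iff (𝓑 : NestInf v) {p : Set K → Prop} :
    (∃ B ∈ 𝓑.balls, p B) ↔ ∃ a γ, closedBall v a γ ∈ 𝓑.balls ∧ p (closedBall v a γ) := by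
  constructor
  · rintro ⟨B, hB, h⟩
    obtain ⟨a, γ, rfl⟩ := 𝓑.isClosedBall B hB
    exact ⟨a, γ, hB, h⟩
  · rintro ⟨a, γ, hB, h⟩
    exact ⟨_, hB, h⟩

variable [IsAlgClosed K]

/-- The maximum is attained, so a lower bound for it is a lower bound at a single member of the
nest. -/
theorem NestInf.le_maxValue_iff (𝓑 : NestInf v) (hv : ∀ γ : Γ, ∃ c : K, v c = γ) {f : K[X]}
    {m : WithTop Γ} : m ≤ 𝓑.maxValue hv f ↔
      ∃ a γ, closedBall v a γ ∈ 𝓑.balls ∧ m ≤ monomialVal v a γ f := by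
  constructor
  · intro h
    obtain ⟨a, γ, hB, hm⟩ := (𝓑.maxValue_spec hv f).1
    exact ⟨a, γ, hB, hm ▸ h⟩
  · rintro ⟨a, γ, hB, h⟩
    exact h.trans ((𝓑.maxValue_spec hv f).2 ⟨a, γ, hB, rfl⟩)

theorem NestInf.lt_maxValue_iff (𝓑 : NestInf v) (hv : ∀ γ : Γ, ∃ c : K, v c = γ) {f : K[X]}
    {m : WithTop Γ} : m < 𝓑.maxValue hv f ↔
      ∃ a γ, closedBall v a γ ∈ 𝓑.balls ∧ m < monomialVal v a γ f := by
  constructor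
  · intro h
    obtain ⟨a, γ, hB, hm⟩ := (𝓑.maxValue_spec hv f).1
    exact ⟨a, γ, hB, hm ▸ h⟩
  · rintro ⟨a, γ, hB, h⟩
    exact h.trans_le ((𝓑.maxValue_spec hv f).2 ⟨a, γ, hB, rfl⟩)

theorem appr_omegaNest (hv : ∀ γ : Γ, ∃ c : K, v c = γ) (𝓑 : NestInf v) :
    (omegaNest hv 𝓑).appr = ballClosure v 𝓑.balls := by
  refine appr_mk_eq_ballClosure hv (fun c d ε hd => ?_) (fun c d ε hd => ?_)
  · change 𝓑.maxValue hv (C d) ≤ 𝓑.maxValue hv (X - C c) ↔ _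
    rw [𝓑.maxValue_C, 𝓑.le_maxValue_iff, 𝓑.exists_ball_iff]
    simp only [monomialVal_linear, hd, le_min_iff, WithTop.coe_le_coe,
      closedBall_subset_closedBall hv, mem_closedBall, v.map_sub_swap c, and_comm]
  · change 𝓑.maxValue hv (C d) < 𝓑.maxValue hv (X - C c) ↔ _
    rw [𝓑.maxValue_C, 𝓑.lt_maxValue_iff, 𝓑.exists_ball_iff]
    simp only [monomialVal_linear, hd, lt_min_iff, WithTop.coe_lt_coe,
      closedBall_subset_openBall hv, mem_openBall, v.map_sub_swap c, and_comm]

end Trace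

/-! ### The order of `𝔹` compared with inclusion of closures. -/

section Poset

variable {K Γ : Type u} [Field K] [AddCommGroup Γ] [LinearOrder Γ] [IsOrderedAddMonoid Γ]
  {v : AddValuation K (WithTop Γ)}

/-- The class of a nest as a point of `𝔹`. -/
abbrev nestPoint (𝓑 : NestInf v) : BSpace v := .nest (Quotient.mk _ 𝓑)

variable (v) in
/-- The ball `B(a, γ)` as a point of `𝔹`. -/
abbrev resPoint (a : K) (γ : Γ) : BSpace v := .ball (.res ⟨closedBall v a γ, a, γ, rfl⟩)

variable (v) in
/-- The ball `B(a, δ)`, with `δ` a cut, as a point of `𝔹`. -/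
abbrev cutPoint (a : K) (δ : Cut Γ) : BSpace v := .ball (.cut ⟨cutBall v a δ, a, δ, rfl⟩)

theorem BSpace.exists_point (b : BSpace v) :
    (∃ 𝓑, b = nestPoint 𝓑) ∨ (∃ a γ, b = resPoint v a γ) ∨ ∃ a δ, b = cutPoint v a δ := by
  rcases b with x | (⟨_, a, γ, rfl⟩ | ⟨_, a, δ, rfl⟩)
  · obtain ⟨𝓑, rfl⟩ := Quotient.exists_rep x
    exact Or.inl ⟨𝓑, rfl⟩
  · exact Or.inr (Or.inl ⟨a, γ, rfl⟩)
  · exact Or.inr (Or.inr ⟨a, δ, rfl⟩)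

theorem nestPoint_le_nestPoint {𝓑 𝓒 : NestInf v} : nestPoint 𝓑 ≤ nestPoint 𝓒 ↔ 𝓑 ≈ 𝓒 :=
  Quotient.eq

/-- Mutual cofinality carries a small member of one representative to any other. -/
theorem resPoint_le_nestPoint {a : K} {γ : Γ} {𝓑 : NestInf v} :
    resPoint v a γ ≤ nestPoint 𝓑 ↔ ∃ B ∈ 𝓑.balls, B ⊆ closedBall v a γ := by
  constructor
  · rintro ⟨𝓒, h, C, hC, hCa⟩
    obtain ⟨B, hB, hBC⟩ := (Quotient.exact h).1 C hC
    exact ⟨B, hB, hBC.trans hCa⟩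
  · rintro ⟨B, hB, h⟩
    exact ⟨𝓑, rfl, B, hB, h⟩

theorem cutPoint_le_nestPoint {a : K} {δ : Cut Γ} {𝓑 : NestInf v} :
    cutPoint v a δ ≤ nestPoint 𝓑 ↔ ∃ B ∈ 𝓑.balls, B ⊆ cutBall v a δ := by
  constructor
  · rintro ⟨𝓒, h, C, hC, hCa⟩
    obtain ⟨B, hB, hBC⟩ := (Quotient.exact h).1 C hC
    exact ⟨B, hB, hBC.trans hCa⟩
  · rintro ⟨B, hB, h⟩
    exact ⟨𝓑, rfl, B, hB, h⟩

theorem not_nestPoint_le_ball {𝓑 : NestInf v} {P : PointedBall v} :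
    ¬ nestPoint 𝓑 ≤ .ball P := id

theorem closedBall_radius_unique (hv : ∀ γ : Γ, ∃ c : K, v c = γ) {a b : K} {γ ε : Γ}
    (h : closedBall v a γ = closedBall v b ε) : γ = ε :=
  le_antisymm (le_of_closedBall_subset hv h.ge).1 (le_of_closedBall_subset hv h.le).1

theorem cutBall_radius_unique (hv : ∀ γ : Γ, ∃ c : K, v c = γ) {a b : K} {δ ε : Cut Γ}
    (h : cutBall v a δ = cutBall v b ε) : δ = ε :=
  Cut.ext_L (Set.Subset.antisymm (subset_of_cutBall_subset hv h.ge)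
    (subset_of_cutBall_subset hv h.le))

theorem hasRadius_res_iff (hv : ∀ γ : Γ, ∃ c : K, v c = γ) {a : K} {γ : Γ} {δ : QCut Γ} :
    (PointedBall.res (v := v) ⟨closedBall v a γ, a, γ, rfl⟩).HasRadius δ ↔
      δ = QCut.principal γ := by
  constructor
  · rintro ⟨b, ε, h, rfl⟩
    rw [closedBall_radius_unique hv h]
  · rintro rfl
    exact ⟨a, γ, rfl, rfl⟩

theorem hasRadius_cut_iff (hv : ∀ γ : Γ, ∃ c : K, v c = γ) {a : K} {ε : Cut Γ} {δ : QCut Γ} :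
    (PointedBall.cut (v := v) ⟨cutBall v a ε, a, ε, rfl⟩).HasRadius δ ↔ δ = ε.toQCut := by
  constructor
  · rintro ⟨b, η, h, rfl⟩
    rw [cutBall_radius_unique hv h]
  · rintro rfl
    exact ⟨a, ε, rfl, rfl⟩

theorem ball_le_ball {P Q : PointedBall v} : (BSpace.ball P ≤ BSpace.ball Q) ↔
    Q.under ⊆ P.under ∧ ∃ δ ε, P.HasRadius δ ∧ Q.HasRadius ε ∧ δ ≤ ε := Iff.rfl

theorem resPoint_le_resPoint (hv : ∀ γ : Γ, ∃ c : K, v c = γ) {a b : K} {γ ε : Γ} :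
    resPoint v a γ ≤ resPoint v b ε ↔ closedBall v b ε ⊆ closedBall v a γ := by
  rw [ball_le_ball]
  refine ⟨fun h => h.1, fun h => ⟨h, _, _, (hasRadius_res_iff hv).2 rfl,
    (hasRadius_res_iff hv).2 rfl, ?_⟩⟩
  have hle := ((closedBall_subset_closedBall hv).1 h).1
  exact ⟨Set.Iic_subset_Iic.2 hle, Set.Ici_subset_Ici.2 hle⟩

theorem Cut.R_subset_of_L_subset {Γ : Type*} [LinearOrder Γ] {δ ε : Cut Γ} (h : δ.L ⊆ ε.L) : ε.R ⊆ δ.R := fun γ hγ =>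
  (δ.mem_R_iff γ).2 fun hL => (ε.mem_R_iff γ).1 hγ (h hL)

theorem cutPoint_le_cutPoint (hv : ∀ γ : Γ, ∃ c : K, v c = γ) {a b : K} {δ ε : Cut Γ} :
    cutPoint v a δ ≤ cutPoint v b ε ↔ cutBall v b ε ⊆ cutBall v a δ := by
  rw [ball_le_ball]
  refine ⟨fun h => h.1, fun h => ⟨h, _, _, (hasRadius_cut_iff hv).2 rfl,
    (hasRadius_cut_iff hv).2 rfl, ?_⟩⟩
  have hle := subset_of_cutBall_subset hv h
  exact ⟨hle, Cut.R_subset_of_L_subset hle⟩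

/-- Inclusion of the underlying sets is not enough here: for the cut `(Γ_{<γ}, Γ_{≥γ})` the cut ball
around `b` equals `B(b, γ)`, but `γ` is not in its lower part. The comparison of radii excludes this
case. -/
theorem resPoint_le_cutPoint (hv : ∀ γ : Γ, ∃ c : K, v c = γ) {a b : K} {γ : Γ} {ε : Cut Γ} :
    resPoint v a γ ≤ cutPoint v b ε ↔ γ ∈ ε.L ∧ b ∈ closedBall v a γ := by
  rw [ball_le_ball]
  constructor
  · rintro ⟨h, δ, η, hδ, hη, hle⟩
    rw [hasRadius_res_iff hv] at hδ
    rw [hasRadius_cut_iff hv] at hη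
    subst hδ hη
    exact ⟨hle.1 (Set.mem_Iic.2 le_rfl), h (self_mem_cutBall b ε)⟩
  · rintro ⟨hγ, hb⟩
    refine ⟨?_, _, _, (hasRadius_res_iff hv).2 rfl, (hasRadius_cut_iff hv).2 rfl,
      fun η hη => Cut.mem_L_of_le hη hγ, fun η hη => (ε.lt γ hγ η hη).le⟩
    change cutBall v b ε ⊆ closedBall v a γ
    rw [closedBall_eq_of_mem hb]
    exact (cutBall_subset_openBall hγ).trans (openBall_subset_closedBall_self b γ)

/-- In this direction inclusion already forces the order of radii: the closed ball lies in each
`B°(a, γ)` with `γ` in `δ^L`, so `γ < ε`. -/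
theorem cutPoint_le_resPoint (hv : ∀ γ : Γ, ∃ c : K, v c = γ) {a b : K} {δ : Cut Γ} {ε : Γ} :
    cutPoint v a δ ≤ resPoint v b ε ↔ closedBall v b ε ⊆ cutBall v a δ := by
  rw [ball_le_ball]
  refine ⟨fun h => h.1, fun h => ⟨h, _, _, (hasRadius_cut_iff hv).2 rfl,
    (hasRadius_res_iff hv).2 rfl, ?_⟩⟩
  have hlt : ∀ γ ∈ δ.L, γ < ε := fun γ hγ =>
    ((closedBall_subset_openBall hv).1 (h.trans (cutBall_subset_openBall hγ))).1
  refine ⟨fun γ hγ => (hlt γ hγ).le, fun η hη => (δ.mem_R_iff η).2 fun hL => ?_⟩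
  exact absurd (hlt η hL) (not_lt.2 hη)

theorem not_cutPoint_le_resPoint_of_le (hv : ∀ γ : Γ, ∃ c : K, v c = γ) {a b : K} {δ : Cut Γ}
    {ε : Γ} (h : resPoint v b ε ≤ cutPoint v a δ) : ¬ cutPoint v a δ ≤ resPoint v b ε := by
  rw [cutPoint_le_resPoint hv]
  rw [resPoint_le_cutPoint hv] at h
  intro h'
  exact lt_irrefl _
    ((closedBall_subset_openBall hv).1 (h'.trans (cutBall_subset_openBall h.1))).1

/-- Balls of the same kind are determined by their underlying sets, and a closed ball and a cut ball
are never below each other in both directions, even when they agree as sets. -/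
theorem BSpace.le_antisymm (hv : ∀ γ : Γ, ∃ c : K, v c = γ) {b c : BSpace v} (h : b ≤ c)
    (h' : c ≤ b) : b = c := by
  obtain ⟨𝓑, rfl⟩ | ⟨a, γ, rfl⟩ | ⟨a, δ, rfl⟩ := b.exists_point <;>
  obtain ⟨𝓒, rfl⟩ | ⟨a', γ', rfl⟩ | ⟨a', δ', rfl⟩ := c.exists_point
  · exact congrArg BSpace.nest h
  · exact absurd h not_nestPoint_le_ball
  · exact absurd h not_nestPoint_le_ball
  · exact absurd h' not_nestPoint_le_ball
  · have := Set.Subset.antisymm ((resPoint_le_resPoint hv).1 h') ((resPoint_le_resPoint hv).1 h)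
    exact congrArg (fun B => BSpace.ball (.res B)) (Subtype.ext this)
  · exact absurd h' (not_cutPoint_le_resPoint_of_le hv h)
  · exact absurd h' not_nestPoint_le_ball
  · exact absurd h (not_cutPoint_le_resPoint_of_le hv h')
  · have := Set.Subset.antisymm ((cutPoint_le_cutPoint hv).1 h') ((cutPoint_le_cutPoint hv).1 h)
    exact congrArg (fun B => BSpace.ball (.cut B)) (Subtype.ext this)

theorem NestInf.isBall (𝓑 : NestInf v) : ∀ B ∈ 𝓑.balls, IsBall v B := fun B hB => by
  obtain ⟨a, γ, rfl⟩ := 𝓑.isClosedBall B hB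
  exact isBall_closedBall a γ

theorem isBall_of_mem_openBallsBelow {a : K} {δ : Cut Γ} :
    ∀ B ∈ openBallsBelow v a δ, IsBall v B := by
  rintro _ ⟨γ, -, rfl⟩
  exact isBall_openBall a γ

theorem isBall_of_mem_singleton {a : K} {γ : Γ} :
    ∀ B ∈ ({closedBall v a γ} : Set (Set K)), IsBall v B := by
  rintro _ rfl
  exact isBall_closedBall a γ

theorem NestInf.nonempty (𝓑 : NestInf v) : 𝓑.balls.Nonempty :=
  let ⟨B, hB, _⟩ := 𝓑.exists_notMem 0
  ⟨B, hB⟩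

theorem NestInf.sInter_ballClosure (𝓑 : NestInf v) : ⋂₀ ballClosure v 𝓑.balls = ∅ := by
  rw [ValTree.sInter_ballClosure 𝓑.isBall, 𝓑.inter]

/-- Some member of the nest omits `a`, and so contains no set through `a`. -/
theorem NestInf.not_ballClosure_subset (𝓑 : NestInf v) {F : Set (Set K)} {a : K}
    (hF : ∀ B ∈ F, a ∈ B) : ¬ ballClosure v 𝓑.balls ⊆ ballClosure v F := by
  rw [ballClosure_subset_ballClosure 𝓑.isBall]
  intro h
  obtain ⟨B, hB, ha⟩ := 𝓑.exists_notMem a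
  obtain ⟨C, hC, hCB⟩ := h B hB
  exact ha (hCB (hF C hC))

/-- Immediate types are maximal: given a point `c` of `C`, some member `D` of `A` omits `c`; being
comparable with `C`, it lies inside `C`. -/
theorem subset_of_isNest_of_sInter_eq_empty {A B : Set (Set K)} (hA : ballClosure v A = A)
    (hB : IsNest v B) (hi : ⋂₀ A = ∅) (h : A ⊆ B) : B ⊆ A := by
  intro C hC
  have hCb := hB.1 C hC
  obtain ⟨c, hc⟩ := IsBall.nonempty hCb
  have hcA : c ∉ ⋂₀ A := by rw [hi]; exact Set.notMem_empty c
  simp only [Set.mem_sInter, not_forall] at hcA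
  obtain ⟨D, hD, hcD⟩ := hcA
  rw [← hA]
  refine ⟨hCb, D, hD, ?_⟩
  exact (hB.2.total (h hD) hC).resolve_right fun h' => hcD (h' hc)

theorem NestInf.ballClosure_subset_iff {𝓑 𝓒 : NestInf v} :
    ballClosure v 𝓑.balls ⊆ ballClosure v 𝓒.balls ↔ 𝓑 ≈ 𝓒 := by
  constructor
  · intro h
    have h' := subset_of_isNest_of_sInter_eq_empty (ballClosure_idem _)
      (isNest_ballClosure 𝓒.isBall 𝓒.chain) 𝓑.sInter_ballClosure h
    exact ⟨(ballClosure_subset_ballClosure 𝓑.isBall).1 h,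
      (ballClosure_subset_ballClosure 𝓒.isBall).1 h'⟩
  · exact fun h => (ballClosure_subset_ballClosure 𝓑.isBall).2 h.1

theorem NestInf.ballClosure_openBallsBelow_subset_iff {a : K} {δ : Cut Γ} {𝓑 : NestInf v} :
    ballClosure v (openBallsBelow v a δ) ⊆ ballClosure v 𝓑.balls ↔
      ∃ B ∈ 𝓑.balls, B ⊆ cutBall v a δ := by
  rw [ballClosure_subset_ballClosure isBall_of_mem_openBallsBelow]
  constructor
  · intro h
    -- One member must lie in all the balls `B°(a, γ)` at once. Any member `B` omitting `a` works:
    -- it meets each such ball, hence is comparable with it, and cannot contain it.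
    obtain ⟨B, hB, ha⟩ := 𝓑.exists_notMem a
    refine ⟨B, hB, fun c hc γ hγ => ?_⟩
    obtain ⟨C, hC, hCa⟩ := h _ ⟨γ, hγ, rfl⟩
    rcases 𝓑.chain.total hB hC with hBC | hCB
    · exact hCa (hBC hc)
    · obtain ⟨d, hd⟩ := (𝓑.isBall C hC).nonempty
      exact ((𝓑.isBall B hB).subset_or_subset (isBall_openBall a γ) (hCB hd) (hCa hd)).elim
        (fun h' => h' hc) fun h' => absurd (h' (self_mem_openBall a γ)) ha
  · rintro ⟨B, hB, h⟩ _ ⟨γ, hγ, rfl⟩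
    exact ⟨B, hB, h.trans (cutBall_subset_openBall hγ)⟩

theorem ballClosure_openBallsBelow_subset_singleton {a b : K} {δ : Cut Γ} {ε : Γ} :
    ballClosure v (openBallsBelow v a δ) ⊆ ballClosure v {closedBall v b ε} ↔
      closedBall v b ε ⊆ cutBall v a δ := by
  rw [ballClosure_subset_ballClosure isBall_of_mem_openBallsBelow]
  simp only [Set.mem_singleton_iff, exists_eq_left]
  constructor
  · exact fun h c hc γ hγ => h _ ⟨γ, hγ, rfl⟩ hc
  · rintro h _ ⟨γ, hγ, rfl⟩
    exact h.trans (cutBall_subset_openBall hγ)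

theorem ballClosure_openBallsBelow_subset_openBallsBelow (hv : ∀ γ : Γ, ∃ c : K, v c = γ)
    {a b : K} {δ ε : Cut Γ} :
    ballClosure v (openBallsBelow v a δ) ⊆ ballClosure v (openBallsBelow v b ε) ↔
      cutBall v b ε ⊆ cutBall v a δ := by
  rw [ballClosure_subset_ballClosure isBall_of_mem_openBallsBelow]
  constructor
  · intro h c hc γ hγ
    obtain ⟨_, ⟨γ', hγ', rfl⟩, h'⟩ := h _ ⟨γ, hγ, rfl⟩
    exact h' (hc γ' hγ')
  · rintro h _ ⟨γ, hγ, rfl⟩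
    -- The radius `γ` is also available around `b`, and `b` lies in `B°(a, γ)`, so the two open
    -- balls of radius `γ` coincide.
    exact (exists_openBallsBelow_subset_openBall hv).2
      ⟨subset_of_cutBall_subset hv h hγ, h (self_mem_cutBall b ε) γ hγ⟩

variable [IsAlgClosed K]

theorem appr_nestPoint (hv : ∀ γ : Γ, ∃ c : K, v c = γ) (𝓑 : NestInf v) :
    (omega v hv (nestPoint 𝓑)).appr = ballClosure v 𝓑.balls := appr_omegaNest hv 𝓑

theorem appr_resPoint (hv : ∀ γ : Γ, ∃ c : K, v c = γ) (a : K) (γ : Γ) :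
    (omega v hv (resPoint v a γ)).appr = ballClosure v {closedBall v a γ} := by
  rw [omega_res, appr_omegaGamma hv]

theorem appr_cutPoint (hv : ∀ γ : Γ, ∃ c : K, v c = γ) (a : K) (δ : Cut Γ) :
    (omega v hv (cutPoint v a δ)).appr = ballClosure v (openBallsBelow v a δ) := by
  rw [omega_cut, appr_omegaCut hv]

theorem appr_omega_subset_iff (hv : ∀ γ : Γ, ∃ c : K, v c = γ) {b c : BSpace v} :
    (omega v hv b).appr ⊆ (omega v hv c).appr ↔ b ≤ c := by
  have hcut : ∀ {a : K} {δ : Cut Γ}, ∀ B ∈ openBallsBelow v a δ, a ∈ B := by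
    rintro a δ _ ⟨γ, -, rfl⟩
    exact self_mem_openBall a γ
  have hres : ∀ {a : K} {γ : Γ}, ∀ B ∈ ({closedBall v a γ} : Set (Set K)), a ∈ B := by
    rintro a γ _ rfl
    exact self_mem_closedBall a γ
  obtain ⟨𝓑, rfl⟩ | ⟨a, γ, rfl⟩ | ⟨a, δ, rfl⟩ := b.exists_point <;>
  obtain ⟨𝓒, rfl⟩ | ⟨a', γ', rfl⟩ | ⟨a', δ', rfl⟩ := c.exists_point <;>
  simp only [appr_nestPoint, appr_resPoint, appr_cutPoint]
  · rw [NestInf.ballClosure_subset_iff, nestPoint_le_nestPoint]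
  · exact iff_of_false (𝓑.not_ballClosure_subset hres) not_nestPoint_le_ball
  · exact iff_of_false (𝓑.not_ballClosure_subset hcut) not_nestPoint_le_ball
  · rw [resPoint_le_nestPoint, ballClosure_subset_ballClosure isBall_of_mem_singleton]
    simp only [Set.mem_singleton_iff, forall_eq]
  · rw [resPoint_le_resPoint hv, ballClosure_subset_ballClosure isBall_of_mem_singleton]
    simp only [Set.mem_singleton_iff, forall_eq, exists_eq_left]
  · rw [resPoint_le_cutPoint hv, ballClosure_subset_ballClosure isBall_of_mem_singleton]
    simp only [Set.mem_singleton_iff, forall_eq,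
      exists_openBallsBelow_subset_closedBall hv (isDivisible hv)]
  · rw [cutPoint_le_nestPoint, NestInf.ballClosure_openBallsBelow_subset_iff]
  · rw [cutPoint_le_resPoint hv, ballClosure_openBallsBelow_subset_singleton]
  · rw [cutPoint_le_cutPoint hv, ballClosure_openBallsBelow_subset_openBallsBelow hv]

end Poset

/-! ### The three kinds of approximation types and surjectivity. -/

section Types

variable {K Γ : Type u} [Field K] [AddCommGroup Γ] [LinearOrder Γ] [IsOrderedAddMonoid Γ]
  {v : AddValuation K (WithTop Γ)}

theorem isChain_openBallsBelow (a : K) (δ : Cut Γ) :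
    IsChain (· ⊆ ·) (openBallsBelow v a δ) := by
  rintro _ ⟨γ, -, rfl⟩ _ ⟨ε, -, rfl⟩ -
  exact (isBall_openBall a γ).subset_or_subset (isBall_openBall a ε) (self_mem_openBall a γ)
    (self_mem_openBall a ε)

theorem NestInf.isImmediate_ballClosure (𝓑 : NestInf v) :
    IsImmediate (ballClosure v 𝓑.balls) :=
  ⟨(𝓑.nonempty.mono (subset_ballClosure 𝓑.isBall)).ne_empty, 𝓑.sInter_ballClosure⟩

theorem isResidueExtending_ballClosure (hv : ∀ γ : Γ, ∃ c : K, v c = γ) (a : K) (γ : Γ) :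
    IsResidueExtending v (ballClosure v {closedBall v a γ}) := by
  refine ⟨γ, ⟨a, subset_ballClosure isBall_of_mem_singleton rfl⟩, ?_⟩
  rintro b ⟨-, _, rfl, h⟩
  exact lt_irrefl _ ((closedBall_subset_openBall hv).1 h).1

theorem isValueExtending_ballClosure (hv : ∀ γ : Γ, ∃ c : K, v c = γ) (hΓ : IsDivisible Γ)
    (a : K) (δ : Cut Γ) : IsValueExtending v (ballClosure v (openBallsBelow v a δ)) := by
  refine Or.inr ⟨⟨a, ?_⟩, ?_⟩
  · rw [sInter_ballClosure isBall_of_mem_openBallsBelow]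
    rintro _ ⟨γ, -, rfl⟩
    exact self_mem_openBall a γ
  · rintro γ ⟨b, -, h⟩
    exact ⟨a, isBall_openBall a γ, _,
      ⟨γ, ((exists_openBallsBelow_subset_closedBall hv hΓ).1 h).1, rfl⟩, subset_rfl⟩

theorem ApproxType.ballClosure_eq (A : ApproxType v) : ballClosure v A.1 = A.1 := by
  rcases A.2 with h | h
  · rw [h]
    exact Set.eq_empty_of_forall_notMem fun _ hB => hB.2.elim fun _ hC => hC.1
  · exact h.2

theorem ApproxType.isBall (A : ApproxType v) : ∀ B ∈ A.1, IsBall v B := fun B hB => by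
  rw [← A.ballClosure_eq] at hB
  exact hB.1

theorem ApproxType.isChain (A : ApproxType v) : IsChain (· ⊆ ·) A.1 := by
  rcases A.2 with h | h
  · rw [h]
    exact Set.pairwise_empty _
  · exact h.1.2

theorem ApproxType.mem_of_subset (A : ApproxType v) {B C : Set K} (hB : B ∈ A.1)
    (hC : IsBall v C) (h : B ⊆ C) : C ∈ A.1 := by
  rw [← A.ballClosure_eq]
  exact ⟨hC, B, hB, h⟩

/-- The closed balls of an immediate type are cofinal in it, so they form a nest with empty
intersection and the same closure. -/
theorem ApproxType.exists_nest (A : ApproxType v) (hA : IsImmediate A.1) :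
    ∃ 𝓑 : NestInf v, ballClosure v 𝓑.balls = A.1 := by
  have hlow : ∀ B ∈ A.1, ∃ C ∈ A.1, (∃ a γ, C = closedBall v a γ) ∧ C ⊆ B := by
    intro B hB
    obtain ⟨a, γ, rfl | rfl⟩ := A.isBall B hB
    · exact ⟨_, hB, ⟨a, γ, rfl⟩, subset_rfl⟩
    · have ha : a ∉ ⋂₀ A.1 := by rw [hA.2]; exact Set.notMem_empty a
      simp only [Set.mem_sInter, not_forall] at ha
      obtain ⟨C, hC, haC⟩ := ha
      have hCB : C ⊆ openBall v a γ := (A.isChain.total hC hB).resolve_right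
        fun h => haC (h (self_mem_openBall a γ))
      obtain ⟨b, hb⟩ := (A.isBall C hC).nonempty
      -- The distance from the centre `a` to a point `b` of a member `C` omitting `a`. The ball
      -- `B(b, η)` contains `a`, hence is larger than `C` and belongs to the type; as `η > γ`, it
      -- lies inside `B°(a, γ)`.
      obtain ⟨η, hη⟩ : ∃ η : Γ, (η : WithTop Γ) = v (a - b) := by
        refine WithTop.ne_top_iff_exists.1 fun h => haC ?_
        rw [sub_eq_zero.1 ((AddValuation.top_iff v).1 h)]
        exact hb
      have hCη : C ⊆ closedBall v b η := by
        refine ((A.isBall C hC).subset_or_subset (isBall_closedBall b η) hb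
          (self_mem_closedBall b η)).resolve_right fun h => haC (h ?_)
        rw [mem_closedBall, hη]
      refine ⟨_, A.mem_of_subset hC (isBall_closedBall b η) hCη, ⟨b, η, rfl⟩, fun c hc => ?_⟩
      have hba : (γ : WithTop Γ) < v (b - a) := hCB hb
      rw [openBall_eq_of_mem (hCB hb)]
      rw [v.map_sub_swap, ← hη] at hba
      exact hba.trans_le hc
  let 𝓑 : NestInf v :=
    { balls := {B ∈ A.1 | ∃ a γ, B = closedBall v a γ}
      isClosedBall := fun B hB => hB.2
      chain := A.isChain.mono fun _ h => h.1
      inter := by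
        rw [← hA.2]
        refine Set.Subset.antisymm (fun c hc B hB => ?_)
          (Set.sInter_subset_sInter fun _ h => h.1)
        obtain ⟨C, hC, hcl, hCB⟩ := hlow B hB
        exact hCB (hc C ⟨hC, hcl⟩) }
  refine ⟨𝓑, Set.Subset.antisymm ?_ fun B hB => ?_⟩
  · rintro B ⟨hB, C, hC, hCB⟩
    exact A.mem_of_subset hC.1 hB hCB
  · obtain ⟨C, hC, hcl, hCB⟩ := hlow B hB
    exact ⟨A.isBall B hB, C, ⟨hC, hcl⟩, hCB⟩

/-- The closed ball of the distinguished radius `γ` is the least member: a ball around `b` that does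
not contain `B(b, γ)` lies in `B°(b, γ)`, which would then belong to the type. -/
theorem ApproxType.exists_res (A : ApproxType v) (hA : IsResidueExtending v A.1) :
    ∃ a γ, ballClosure v {closedBall v a γ} = A.1 := by
  obtain ⟨γ, ⟨a, ha⟩, hopen⟩ := hA
  refine ⟨a, γ, Set.Subset.antisymm ?_ fun B hB => ⟨A.isBall B hB, _, rfl, ?_⟩⟩
  · rintro B ⟨hB, _, rfl, h⟩
    exact A.mem_of_subset ha hB h
  · refine (A.isChain.total ha hB).elim id fun h => ?_
    obtain ⟨b, hb⟩ := (A.isBall B hB).nonempty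
    rw [closedBall_eq_of_mem (h hb)]
    refine ((A.isBall B hB).subset_or_subset (isBall_openBall b γ) hb
      (self_mem_openBall b γ)).elim
      (fun h' => absurd (A.mem_of_subset hB (isBall_openBall b γ) h') (hopen b)) fun h' => ?_
    obtain ⟨ε, rfl | rfl⟩ := (A.isBall B hB).eq_of_mem hb
    · by_contra hn
      have hlt : γ < ε := by
        by_contra! hle
        exact hn fun x hx => (WithTop.coe_le_coe.2 hle).trans hx
      exact hopen b (A.mem_of_subset hB (isBall_openBall b γ)
        fun x hx => (WithTop.coe_lt_coe.2 hlt).trans_le hx)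
    · by_contra hn
      have hle : γ ≤ ε := by
        by_contra! hlt
        exact hn fun x hx => (WithTop.coe_lt_coe.2 hlt).trans_le hx
      exact hopen b (A.mem_of_subset hB (isBall_openBall b γ)
        fun x hx => (WithTop.coe_le_coe.2 hle).trans_lt hx)

/-- The lower part of the cut is the support, and the centre is any common point of the members. -/
theorem ApproxType.exists_cut (A : ApproxType v) (hA : IsValueExtending v A.1) :
    ∃ a δ, ballClosure v (openBallsBelow v a δ) = A.1 := by
  rcases hA with hA | ⟨⟨a, ha⟩, hopen⟩
  -- The empty type comes from the cut with empty lower part, whose ball is all of `K`; the centre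
  -- is arbitrary.
  · refine ⟨0, ⟨∅, Set.univ, fun _ h => h.elim, Set.empty_union _⟩, ?_⟩
    rw [hA]
    refine Set.eq_empty_of_forall_notMem ?_
    rintro B ⟨-, _, ⟨γ, h, -⟩, -⟩
    exact h
  · have hcl : ∀ {γ}, γ ∈ supp v A.1 → closedBall v a γ ∈ A.1 := by
      rintro γ ⟨b, hb⟩
      rwa [← closedBall_eq_of_mem (ha _ hb)]
    have hop : ∀ {γ}, γ ∈ supp v A.1 → openBall v a γ ∈ A.1 := by
      intro γ hγ
      obtain ⟨b, hb⟩ := hopen γ hγ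
      rwa [← openBall_eq_of_mem (ha _ hb)]
    refine ⟨a, ⟨supp v A.1, (supp v A.1)ᶜ, fun γ hγ ε hε => ?_, Set.union_compl_self _⟩, ?_⟩
    -- The support is an initial segment, because a closed ball around `a` of smaller radius is
    -- larger and so stays in the type.
    · by_contra! hle
      exact hε ⟨a, A.mem_of_subset (hcl hγ) (isBall_closedBall a ε)
        fun x hx => (WithTop.coe_le_coe.2 hle).trans hx⟩
    · refine Set.Subset.antisymm ?_ fun B hB => ?_
      · rintro B ⟨hB, _, ⟨γ, hγ, rfl⟩, h⟩
        exact A.mem_of_subset (hop hγ) hB h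
      -- Recentred at `a`, a member of either kind has its radius in the support: for an open ball,
      -- the closed ball of the same radius is larger and hence a member.
      · obtain ⟨γ, rfl | rfl⟩ := (A.isBall B hB).eq_of_mem (ha B hB)
        · exact ⟨isBall_closedBall a γ, _, ⟨γ, ⟨a, hB⟩, rfl⟩, openBall_subset_closedBall_self a γ⟩
        · exact ⟨isBall_openBall a γ, _, ⟨γ, ⟨a, A.mem_of_subset hB (isBall_closedBall a γ)
            (openBall_subset_closedBall_self a γ)⟩, rfl⟩, subset_rfl⟩

/-- For a nonempty type with a common point, failure of the condition on open balls is precisely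
residue-extension. -/
theorem ApproxType.trichotomy (A : ApproxType v) :
    IsImmediate A.1 ∨ IsResidueExtending v A.1 ∨ IsValueExtending v A.1 := by
  by_cases h0 : A.1 = ∅
  · exact Or.inr (Or.inr (Or.inl h0))
  by_cases h1 : ⋂₀ A.1 = ∅
  · exact Or.inl ⟨h0, h1⟩
  by_cases h2 : ∀ γ ∈ supp v A.1, ∃ a, openBall v a γ ∈ A.1
  · exact Or.inr (Or.inr (Or.inr ⟨Set.nonempty_iff_ne_empty.2 h1, h2⟩))
  · push Not at h2
    exact Or.inr (Or.inl h2)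

variable [IsAlgClosed K]

theorem isApproxType_appr_omega (hv : ∀ γ : Γ, ∃ c : K, v c = γ) (b : BSpace v) :
    (omega v hv b).appr = ∅ ∨ (IsNest v (omega v hv b).appr ∧
      ballClosure v (omega v hv b).appr = (omega v hv b).appr) := by
  refine Or.inr ?_
  obtain ⟨𝓑, rfl⟩ | ⟨a, γ, rfl⟩ | ⟨a, δ, rfl⟩ := b.exists_point
  · rw [appr_nestPoint]
    exact ⟨isNest_ballClosure 𝓑.isBall 𝓑.chain, ballClosure_idem _⟩
  · rw [appr_resPoint]
    exact ⟨isNest_ballClosure isBall_of_mem_singleton IsChain.singleton, ballClosure_idem _⟩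
  · rw [appr_cutPoint]
    exact ⟨isNest_ballClosure isBall_of_mem_openBallsBelow (isChain_openBallsBelow a δ),
      ballClosure_idem _⟩

/-- The map `B ↦ appr_{ω_B}(x, K)` from `𝔹` to the approximation types. -/
noncomputable def apprMap (hv : ∀ γ : Γ, ∃ c : K, v c = γ) (b : BSpace v) : ApproxType v :=
  ⟨(omega v hv b).appr, isApproxType_appr_omega hv b⟩

theorem apprMap_le_iff (hv : ∀ γ : Γ, ∃ c : K, v c = γ) {b c : BSpace v} :
    apprMap hv b ≤ apprMap hv c ↔ b ≤ c := appr_omega_subset_iff hv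

theorem apprMap_injective (hv : ∀ γ : Γ, ∃ c : K, v c = γ) :
    Function.Injective (apprMap (v := v) hv) := fun _ _ h =>
  BSpace.le_antisymm hv ((apprMap_le_iff hv).1 h.le) ((apprMap_le_iff hv).1 h.ge)

theorem ApproxType.exists_apprMap_nest (hv : ∀ γ : Γ, ∃ c : K, v c = γ) (A : ApproxType v)
    (hA : IsImmediate A.1) : ∃ x, apprMap hv (.nest x) = A := by
  obtain ⟨𝓑, h⟩ := A.exists_nest hA
  exact ⟨Quotient.mk _ 𝓑, Subtype.ext ((appr_nestPoint hv 𝓑).trans h)⟩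

theorem ApproxType.exists_apprMap_res (hv : ∀ γ : Γ, ∃ c : K, v c = γ) (A : ApproxType v)
    (hA : IsResidueExtending v A.1) : ∃ B, apprMap hv (.ball (.res B)) = A := by
  obtain ⟨a, γ, h⟩ := A.exists_res hA
  exact ⟨⟨closedBall v a γ, a, γ, rfl⟩, Subtype.ext ((appr_resPoint hv a γ).trans h)⟩

theorem ApproxType.exists_apprMap_cut (hv : ∀ γ : Γ, ∃ c : K, v c = γ) (A : ApproxType v)
    (hA : IsValueExtending v A.1) : ∃ B, apprMap hv (.ball (.cut B)) = A := by
  obtain ⟨a, δ, h⟩ := A.exists_cut hA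
  exact ⟨⟨cutBall v a δ, a, δ, rfl⟩, Subtype.ext ((appr_cutPoint hv a δ).trans h)⟩

theorem apprMap_surjective (hv : ∀ γ : Γ, ∃ c : K, v c = γ) :
    Function.Surjective (apprMap (v := v) hv) := by
  intro A
  rcases A.trichotomy with hA | hA | hA
  · exact (A.exists_apprMap_nest hv hA).imp' _ fun _ => id
  · exact (A.exists_apprMap_res hv hA).imp' _ fun _ => id
  · exact (A.exists_apprMap_cut hv hA).imp' _ fun _ => id

/-- Restricts the global isomorphism to one summand of `𝔹`; only the kind of the image and
surjectivity onto that kind remain to be supplied. -/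
theorem exists_orderIso_restrict {P : ApproxType v → Prop} {T : Type*} [LE T]
    (hv : ∀ γ : Γ, ∃ c : K, v c = γ) (ι : T → BSpace v) (hι : Function.Injective ι)
    (hle : ∀ x y, ι x ≤ ι y ↔ x ≤ y) (hP : ∀ x, P (apprMap hv (ι x)))
    (hs : ∀ A, P A → ∃ x, apprMap hv (ι x) = A) :
    ∃ e : T ≃o {A : ApproxType v // P A}, ∀ x, (e x).1 = apprMap hv (ι x) := by
  let f : T → {A : ApproxType v // P A} := fun x => ⟨apprMap hv (ι x), hP x⟩
  have hf : Function.Bijective f := by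
    constructor
    · exact fun x y h => hι (apprMap_injective hv (congrArg Subtype.val h))
    · rintro ⟨A, hA⟩
      exact (hs A hA).imp fun x hx => Subtype.ext hx
  exact ⟨⟨Equiv.ofBijective f hf, (apprMap_le_iff hv).trans (hle _ _)⟩, fun _ => rfl⟩

end Types

end ValTree

/-! ### Assembly of the isomorphism and its restrictions. -/

theorem mainTheorem6 {K Γ : Type u} [Field K] [IsAlgClosed K]
    [AddCommGroup Γ] [LinearOrder Γ] [IsOrderedAddMonoid Γ]
    (v : AddValuation K (WithTop Γ)) (hv : ∀ γ : Γ, ∃ c : K, v c = γ) :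
    ∃ Φ : ValTree.BSpace v ≃o ValTree.ApproxType v,
      (∀ b : ValTree.BSpace v, (Φ b).1 = (ValTree.omega v hv b).appr) ∧
      (∃ e : ValTree.BInf v ≃o {A : ValTree.ApproxType v // ValTree.IsImmediate A.1},
        ∀ x : ValTree.BInf v, (e x).1 = Φ (.nest x)) ∧
      (∃ e : ValTree.BGamma v ≃o {A : ValTree.ApproxType v // ValTree.IsResidueExtending v A.1},
        ∀ B : ValTree.BGamma v, (e B).1 = Φ (.ball (.res B))) ∧
      (∃ e : ValTree.BCut v ≃o {A : ValTree.ApproxType v // ValTree.IsValueExtending v A.1},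
        ∀ B : ValTree.BCut v, (e B).1 = Φ (.ball (.cut B))) ∧
      (∀ 𝓑 : ValTree.NestInf v,
        (Φ (.nest (Quotient.mk _ 𝓑))).1 = ValTree.ballClosure v 𝓑.balls) ∧
      (∀ (a : K) (γ : Γ),
        (Φ (.ball (.res ⟨ValTree.closedBall v a γ, a, γ, rfl⟩))).1 =
          ValTree.ballClosure v {ValTree.closedBall v a γ}) ∧
      (∀ (a : K) (δ : ValTree.Cut Γ),
        (Φ (.ball (.cut ⟨ValTree.cutBall v a δ, a, δ, rfl⟩))).1 =
          ValTree.ballClosure v {B | ∃ γ ∈ δ.L, B = ValTree.openBall v a γ}) := by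
  refine ⟨⟨Equiv.ofBijective (ValTree.apprMap hv)
    ⟨ValTree.apprMap_injective hv, ValTree.apprMap_surjective hv⟩, ValTree.apprMap_le_iff hv⟩,
    fun _ => rfl, ?_, ?_, ?_, ValTree.appr_nestPoint hv, ValTree.appr_resPoint hv,
    ValTree.appr_cutPoint hv⟩
  · refine ValTree.exists_orderIso_restrict hv _ (fun _ _ h => ValTree.BSpace.nest.inj h)
      (fun _ _ => Iff.rfl) (fun x => ?_) fun A hA => A.exists_apprMap_nest hv hA
    obtain ⟨𝓑, rfl⟩ := Quotient.exists_rep x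
    change ValTree.IsImmediate (ValTree.omega v hv (ValTree.nestPoint 𝓑)).appr
    rw [ValTree.appr_nestPoint]
    exact 𝓑.isImmediate_ballClosure
  · refine ValTree.exists_orderIso_restrict hv (fun B => .ball (.res B))
      (fun _ _ h => ValTree.PointedBall.res.inj (ValTree.BSpace.ball.inj h)) ?_ ?_
      fun A hA => A.exists_apprMap_res hv hA
    · rintro ⟨_, a, γ, rfl⟩ ⟨_, b, ε, rfl⟩
      exact ValTree.resPoint_le_resPoint hv
    · rintro ⟨_, a, γ, rfl⟩
      change ValTree.IsResidueExtending v (ValTree.omega v hv (ValTree.resPoint v a γ)).appr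
      rw [ValTree.appr_resPoint]
      exact ValTree.isResidueExtending_ballClosure hv a γ
  · refine ValTree.exists_orderIso_restrict hv (fun B => .ball (.cut B))
      (fun _ _ h => ValTree.PointedBall.cut.inj (ValTree.BSpace.ball.inj h)) ?_ ?_
      fun A hA => A.exists_apprMap_cut hv hA
    · rintro ⟨_, a, γ, rfl⟩ ⟨_, b, ε, rfl⟩
      exact ValTree.cutPoint_le_cutPoint hv
    · rintro ⟨_, a, δ, rfl⟩
      change ValTree.IsValueExtending v (ValTree.omega v hv (ValTree.cutPoint v a δ)).appr
      rw [ValTree.appr_cutPoint]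
      exact ValTree.isValueExtending_ballClosure hv (ValTree.isDivisible hv) a δ
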